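/- Let $T\in(0,\infty)$, $\tau\in(0,T)$, $d\in\{2,3,\ldots\}$, $\xi\in\mathbb R^d$, let $(\varepsilon_n)_{n\in\mathbb N}\subseteq(0,\tau]$ and let $(\delta_n)_{n\in\mathbb N}\subseteq\mathbb R$ satisfy $\limsup_{n\to\infty}\delta_n\le 0$. Then there exist infinitely often differentiable and globally bounded functions $\mu,\sigma\colon\mathbb R^d\to\mathbb R^d$ and a Borel measurable function $\Phi\colon C([0,T],\mathbb R)\to\mathbb R$ such that for every probability space $(\Omega,\mathcal F,\mathbb P)$, every normal filtration $\mathbb F=(\mathbb F_t)_{t\in[0,T]}$ on it (that is, $\mathbb F_0$ contains all $A\in\mathcal F$ with $\mathbb P(A)=0$, and $\mathbb F_t=\bigcap_{s\in(t,T]}\mathbb F_s$ for all $t\in[0,T)$), every standard real-valued Brownian motion $W\colon[0,T]\times\Omega\to\mathbb R$ with respect to $\mathbb F$ with continuous paths, every continuous $\mathbb F$-adapted stochastic process $X=(X^{(1)},\ldots,X^{(d)})\colon[0,T]\times\Omega\to\mathbb R^d$ which satisfies for all $t\in[0,T]$ that $$\mathbb P\Big(X_t=\xi+\int_0^t\mu(X_s)\,ds+\int_0^t\sigma(X_s)\,dW_s\Big)=1$$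 (the last integral being an Itô integral), and every $n\in\mathbb N$ it holds that $$\mathbb P\Big(X_T^{(1)}=\Phi\big((W_s)_{s\in[0,T]}\big)\Big)=1$$ and $$\inf_{\substack{a,b\in[0,\tau],\\ b-a\ge\varepsilon_n}}\ \inf_{\substack{u\colon C([0,a]\cup[b,T],\mathbb R)\to\mathbb R\\ \text{measurable}}}\mathbb E\Big[\big|X_T^{(1)}-u\big((W_s)_{s\in[0,a]\cup[b,T]}\big)\big|\Big]\ge\delta_n.$$ Here spaces of continuous functions carry the Borel $\sigma$-algebra of the uniform norm. -/

import Mathlib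

open MeasureTheory ProbabilityTheory Filter Topology Set
open scoped ENNReal

namespace SlowSDE

/-! The time interval `[0, T]` is the subtype `Icc (0 : ℝ) T` of `ℝ`, with its order, topology
and Borel σ-algebra. -/

/-- Lebesgue measure on `[0, T]`. -/
noncomputable def lebesgue (T : ℝ) : Measure (Icc (0 : ℝ) T) :=
  Measure.comap Subtype.val volume

/-- A filtration on a probability space, indexed by `[0, T]`, is normal if every measurable null
set belongs to each `𝓕 t` (equivalently, to `𝓕 0`) and `𝓕 t = ⋂ s > t, 𝓕 s` for `t < T`. -/
structure IsNormalFiltration {Ω : Type*} {mΩ : MeasurableSpace Ω} {T : ℝ} (P : Measure Ω)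
    (𝓕 : Filtration (Icc (0 : ℝ) T) mΩ) : Prop where
  null_mem : ∀ (t : Icc (0 : ℝ) T) (A : Set Ω), MeasurableSet A → P A = 0 → MeasurableSet[𝓕 t] A
  right_continuous : ∀ t : Icc (0 : ℝ) T, (t : ℝ) < T → (⨅ s > t, 𝓕 s) = 𝓕 t

/-- `W` is a standard real Brownian motion on `[0, T]` with respect to the filtration `𝓕`. -/
structure IsBrownianMotion {Ω : Type*} {mΩ : MeasurableSpace Ω} {T : ℝ} (P : Measure Ω)
    (𝓕 : Filtration (Icc (0 : ℝ) T) mΩ) (W : Icc (0 : ℝ) T → Ω → ℝ) : Prop where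
  adapted : StronglyAdapted 𝓕 W
  continuous_paths : ∀ ω, Continuous fun t => W t ω
  zero : ∀ t : Icc (0 : ℝ) T, (t : ℝ) = 0 → ∀ᵐ ω ∂P, W t ω = 0
  increment_law : ∀ s t : Icc (0 : ℝ) T, s ≤ t →
    HasLaw (fun ω => W t ω - W s ω) (gaussianReal 0 (Real.toNNReal ((t : ℝ) - (s : ℝ)))) P
  increment_indep : ∀ s t : Icc (0 : ℝ) T, s ≤ t →
    Indep (MeasurableSpace.comap (fun ω => W t ω - W s ω) inferInstance) (𝓕 s) P

/-- A simple (elementary predictable) process: a finite sum of terms `ζ 1_{(s, r]}` in which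
`s ≤ r` and `ζ` is bounded and `𝓕 s`-measurable. -/
structure SimpleProcess {Ω : Type*} {mΩ : MeasurableSpace Ω} {T : ℝ}
    (𝓕 : Filtration (Icc (0 : ℝ) T) mΩ) (E : Type*) [NormedAddCommGroup E] where
  /-- the number of terms -/
  size : ℕ
  /-- the left end points `s` -/
  left : Fin size → Icc (0 : ℝ) T
  /-- the right end points `r` -/
  right : Fin size → Icc (0 : ℝ) T
  left_le_right : ∀ i, left i ≤ right i
  /-- the coefficients `ζ` -/
  coef : Fin size → Ω → E
  coef_measurable : ∀ i, StronglyMeasurable[𝓕 (left i)] (coef i)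
  coef_bounded : ∀ i, ∃ C : ℝ, ∀ ω, ‖coef i ω‖ ≤ C

section Integral

variable {Ω : Type*} {mΩ : MeasurableSpace Ω} {T : ℝ} {𝓕 : Filtration (Icc (0 : ℝ) T) mΩ}
  {E : Type*} [NormedAddCommGroup E] [NormedSpace ℝ E]

/-- The value of a simple process at time `t`. -/
noncomputable def SimpleProcess.val (S : SimpleProcess 𝓕 E) (t : Icc (0 : ℝ) T) (ω : Ω) : E :=
  ∑ i, (Ioc (S.left i) (S.right i)).indicator (fun _ => S.coef i ω) t

/-- The stochastic integral `∫_0^t S dW` of a simple process: the sum of the terms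
`(W_{min t r} - W_{min t s}) ζ`. -/
noncomputable def SimpleProcess.integral (S : SimpleProcess 𝓕 E) (W : Icc (0 : ℝ) T → Ω → ℝ)
    (t : Icc (0 : ℝ) T) (ω : Ω) : E :=
  ∑ i, (W (min t (S.right i)) ω - W (min t (S.left i)) ω) • S.coef i ω

/-- The random variable `I` is a version of the Itô integral `∫_0^t H_s dW_s` of the
(progressively measurable, square integrable) process `H`: it is the `L²(P)`-limit of the
integrals of some simple processes that converge to `H` in `L²([0, t] × Ω)`. By the Itô isometry
such an `I` exists and is almost surely unique. -/
structure IsItoIntegral (P : Measure Ω) (𝓕 : Filtration (Icc (0 : ℝ) T) mΩ)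
    (W : Icc (0 : ℝ) T → Ω → ℝ) (H : Icc (0 : ℝ) T → Ω → E) (t : Icc (0 : ℝ) T)
    (I : Ω → E) : Prop where
  progressive : IsStronglyProgressive 𝓕 H
  aestronglyMeasurable : AEStronglyMeasurable I P
  limit : ∃ S : ℕ → SimpleProcess 𝓕 E,
    Tendsto (fun n => ∫⁻ ω, (∫⁻ s in Iic t, ‖(S n).val s ω - H s ω‖ₑ ^ 2 ∂(lebesgue T)) ∂P) atTop (𝓝 0) ∧
    Tendsto (fun n => ∫⁻ ω, ‖(S n).integral W t ω - I ω‖ₑ ^ 2 ∂P) atTop (𝓝 0)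

/-- `X` is a continuous `𝓕`-adapted process on `[0, T]` such that for every `t ∈ [0, T]`, almost
surely, `X_t = ξ + ∫_0^t μ(X_s) ds + ∫_0^t σ(X_s) dW_s`; the coefficient `σ` is meant to be
bounded and continuous, so that the Itô integral is the square integrable one. -/
structure IsSDESolution (P : Measure Ω) (𝓕 : Filtration (Icc (0 : ℝ) T) mΩ)
    (W : Icc (0 : ℝ) T → Ω → ℝ) (ξ : E) (μ σ : E → E) (X : Icc (0 : ℝ) T → Ω → E) : Prop where
  adapted : StronglyAdapted 𝓕 X
  continuous_paths : ∀ ω, Continuous fun t => X t ω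
  equation : ∀ t : Icc (0 : ℝ) T, ∃ I : Ω → E,
    IsItoIntegral P 𝓕 W (fun s ω => σ (X s ω)) t I ∧
    ∀ᵐ ω ∂P, X t ω = ξ + (∫ s in Iic t, μ (X s ω) ∂(lebesgue T)) + I ω

end Integral

/-- The path `(W_s(ω))_{s ∈ [0, T]}` of a continuous process, as an element of `C([0, T], ℝ)`. -/
def path {Ω : Type*} {T : ℝ} (W : Icc (0 : ℝ) T → Ω → ℝ) (hW : ∀ ω, Continuous fun t => W t ω)
    (ω : Ω) : C(Icc (0 : ℝ) T, ℝ) :=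
  ⟨fun t => W t ω, hW ω⟩

end SlowSDE

open SlowSDE

/-! Two coordinates carry the dynamics: a signal `x` and a clock `y`, measured from its initial
value. The clock runs at speed `1 / (1 - h(x) χ(y))`, and the signal satisfies `dx = κ(y) dt + f(y)
dW`. Up to time `τ` the cutoff `χ` vanishes, so `y = t` and the noise intensity is the deterministic
`f(t)`, which vanishes from `τ` on. With `g = -f'`, integration by parts shows that the signal then
equals `z = ξ + ∫ g(s) W_s ds`, a continuous functional of the path.

Next the signal is frozen at `z` while `χ` is active. Separation of variables shows that the clock
gains the total lead `h(z) ∫ χ`. Finally `κ` converts this lead into a displacement of the signal: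
since the clock has speed `1` wherever `κ` is nonzero, the displacement is `∫ κ` up to the final
clock reading. The result is `x_T = F(z)` with `F(z) = z + m + M h(z)`. Storing `h(z)` in the clock
lets two coordinates suffice, although the equation is autonomous and the signal must not move while
`h` reads it (`IsProfile.signal_terminal`, `IsSDESolution.coord_terminal`).

For the lower bound, split `W` into its deviation at the midpoint of `[a, b]` from linear
interpolation, and an independent residual that agrees with `W` outside `(a, b)`. Then `z = α(U) +
B`, where `U` is the residual path and `B` is an independent centred Gaussian whose variance is
bounded below in terms of `b - a`. On `[4k - 1, 4k + 1]` the function `h` oscillates with frequency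
`N k`. The test function `cos (N k x)` on this interval correlates with `F`, but its conditional
mean given `U` is tiny once `N k` is large compared with the inverse variance of `B`. Hence no
function of `U` approximates `F(z)` better than a multiple of the probability `p k` that `z` lies in
this interval (`le_lintegral_sub_of_indepFun`, `exists_oscillation_test`).

The bound `M p k / 64` is available for every `k` at once, and the required hidden variance may
depend on `k` arbitrarily. Since `limsup δ ≤ 0`, only finitely many indices `n` have `δ n` above a
given positive level. So each `n` can be assigned a `k` with `δ n ≤ M p k / 64` and `ε n` above a
positive threshold depending only on `k` (`exists_threshold`). -/

namespace SlowSDE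

/-! ### Brownian increments and the elementary Itô isometry -/

section Brownian

variable {Ω : Type*} {mΩ : MeasurableSpace Ω} {T : ℝ} {P : Measure Ω}
  {𝓕 : Filtration (Icc (0 : ℝ) T) mΩ} {W : Icc (0 : ℝ) T → Ω → ℝ}

lemma lebesgue_Ioc (p q : Icc (0 : ℝ) T) :
    lebesgue T (Ioc p q) = ENNReal.ofReal ((q : ℝ) - p) := by
  rw [lebesgue, comap_subtype_coe_apply measurableSet_Icc]
  have : Subtype.val '' Ioc p q = Ioc (p : ℝ) q := by
    ext x
    constructor
    · rintro ⟨y, hy, rfl⟩; exact hy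
    · intro hx
      exact ⟨⟨x, p.2.1.trans hx.1.le, hx.2.trans q.2.2⟩, hx, rfl⟩
  rw [this, Real.volume_Ioc]

instance : IsFiniteMeasure (lebesgue T) := by
  constructor
  rw [lebesgue, comap_subtype_coe_apply measurableSet_Icc, image_univ, Subtype.range_coe,
    Real.volume_Icc]
  exact ENNReal.ofReal_lt_top

namespace IsBrownianMotion

lemma measurable (hW : IsBrownianMotion P 𝓕 W) (t : Icc (0 : ℝ) T) : Measurable (W t) :=
  ((hW.adapted t).mono (𝓕.le t)).measurable

lemma hasGaussianLaw_sub (hW : IsBrownianMotion P 𝓕 W) {s t : Icc (0 : ℝ) T} (hst : s ≤ t) :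
    HasGaussianLaw (fun ω => W t ω - W s ω) P :=
  (hW.increment_law s t hst).hasGaussianLaw

lemma memLp_sub (hW : IsBrownianMotion P 𝓕 W) {s t : Icc (0 : ℝ) T} (hst : s ≤ t) :
    MemLp (fun ω => W t ω - W s ω) 2 P :=
  (hW.hasGaussianLaw_sub hst).memLp_two

lemma integral_sub (hW : IsBrownianMotion P 𝓕 W) {s t : Icc (0 : ℝ) T} (hst : s ≤ t) :
    ∫ ω, (W t ω - W s ω) ∂P = 0 := by
  rw [(hW.increment_law s t hst).integral_eq, integral_id_gaussianReal]

lemma integral_sub_sq (hW : IsBrownianMotion P 𝓕 W) {s t : Icc (0 : ℝ) T} (hst : s ≤ t) :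
    ∫ ω, (W t ω - W s ω) ^ 2 ∂P = (t : ℝ) - s := by
  have := (hW.hasGaussianLaw_sub hst).isProbabilityMeasure
  have h := (hW.increment_law s t hst).variance_eq
  rw [variance_of_integral_eq_zero (hW.hasGaussianLaw_sub hst).aemeasurable
    (hW.integral_sub hst), variance_id_gaussianReal] at h
  rw [h, Real.coe_toNNReal]
  exact sub_nonneg.2 hst

lemma indepFun_sub (hW : IsBrownianMotion P 𝓕 W) {s t : Icc (0 : ℝ) T} (hst : s ≤ t)
    {Z : Ω → ℝ} (hZ : StronglyMeasurable[𝓕 s] Z) :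
    IndepFun (fun ω => W t ω - W s ω) Z P :=
  indep_of_indep_of_le_right (hW.increment_indep s t hst) hZ.measurable.comap_le

lemma integral_sub_mul (hW : IsBrownianMotion P 𝓕 W) {s t : Icc (0 : ℝ) T} (hst : s ≤ t)
    {Z : Ω → ℝ} (hZ : StronglyMeasurable[𝓕 s] Z) :
    ∫ ω, (W t ω - W s ω) * Z ω ∂P = 0 := by
  have h := (hW.indepFun_sub hst hZ).integral_mul_eq_mul_integral
    (hW.memLp_sub hst).aestronglyMeasurable (hZ.mono (𝓕.le s)).aestronglyMeasurable
  rw [hW.integral_sub hst, zero_mul] at h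
  exact h

lemma integral_sub_sq_mul (hW : IsBrownianMotion P 𝓕 W) {s t : Icc (0 : ℝ) T} (hst : s ≤ t)
    {Z : Ω → ℝ} (hZ : StronglyMeasurable[𝓕 s] Z) :
    ∫ ω, (W t ω - W s ω) ^ 2 * Z ω ∂P = ((t : ℝ) - s) * ∫ ω, Z ω ∂P := by
  have h0 : IndepFun (fun ω => (W t ω - W s ω) ^ 2) Z P :=
    (hW.indepFun_sub hst hZ).comp (φ := fun x => x ^ 2) (ψ := id) (by fun_prop) measurable_id
  have h := h0.integral_mul_eq_mul_integral
    (hW.memLp_sub hst).integrable_sq.aestronglyMeasurable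
    (hZ.mono (𝓕.le s)).aestronglyMeasurable
  rw [hW.integral_sub_sq hst] at h
  exact h

/-- Second moments of two terms of an elementary stochastic integral, the second of which starts
later. -/
lemma integral_term_mul_term (hW : IsBrownianMotion P 𝓕 W) {l r p q : Icc (0 : ℝ) T}
    (hlp : l ≤ p) (hpq : p ≤ q) {Z : Ω → ℝ} (hZ : StronglyMeasurable[𝓕 p] Z)
    {C : ℝ} (hC : ∀ ω, ‖Z ω‖ ≤ C) :
    ∫ ω, (W r ω - W l ω) * (W q ω - W p ω) * Z ω ∂P
      = max 0 ((min r q : Icc (0 : ℝ) T) - (p : ℝ)) * ∫ ω, Z ω ∂P := by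
  have hZm := (hZ.mono (𝓕.le p)).aestronglyMeasurable (μ := P)
  have key : ∀ {s t u v : Icc (0 : ℝ) T}, s ≤ t → u ≤ v →
      Integrable (fun ω => (W t ω - W s ω) * (W v ω - W u ω) * Z ω) P := by
    intro s t u v hst huv
    exact (hW.memLp_sub hst).integrable_mul (hW.memLp_sub huv) |>.mul_bdd (c := C) hZm
      (ae_of_all _ hC)
  have hmeas : ∀ {s : Icc (0 : ℝ) T}, s ≤ p → StronglyMeasurable[𝓕 p] (W s) := fun hs =>
    (hW.adapted _).mono (𝓕.mono hs)
  rcases le_total r p with hrp | hpr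
  · have h1 : ∫ ω, (W r ω - W l ω) * (W q ω - W p ω) * Z ω ∂P = 0 := by
      have := hW.integral_sub_mul hpq (((hmeas hrp).sub (hmeas hlp)).mul hZ)
      rw [← this]
      congr 1; ext ω; simp; ring
    have h2 : ((min r q : Icc (0 : ℝ) T) : ℝ) ≤ p := (min_le_left r q).trans hrp
    rw [h1, max_eq_left (by linarith), zero_mul]
  · have h1 : ∫ ω, (W p ω - W l ω) * (W q ω - W p ω) * Z ω ∂P = 0 := by
      have := hW.integral_sub_mul hpq (((hmeas le_rfl).sub (hmeas hlp)).mul hZ)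
      rw [← this]
      congr 1; ext ω; simp; ring
    have h2 : ∀ {u v : Icc (0 : ℝ) T}, p ≤ u → u ≤ v →
        ∫ ω, (W u ω - W p ω) * (W v ω - W p ω) * Z ω ∂P = ((u : ℝ) - p) * ∫ ω, Z ω ∂P := by
      intro u v hpu huv
      have h3 : ∫ ω, (W u ω - W p ω) * (W v ω - W u ω) * Z ω ∂P = 0 := by
        have hm : StronglyMeasurable[𝓕 u] fun ω => (W u ω - W p ω) * Z ω :=
          ((hW.adapted u).sub ((hW.adapted p).mono (𝓕.mono hpu))).mul (hZ.mono (𝓕.mono hpu))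
        rw [← hW.integral_sub_mul huv hm]
        congr 1; ext ω; ring
      rw [← hW.integral_sub_sq_mul hpu hZ, ← add_zero (∫ ω, (W u ω - W p ω) ^ 2 * Z ω ∂P), ← h3,
        ← integral_add]
      · congr 1; ext ω; ring
      · have := key hpu hpu
        refine this.congr (ae_of_all _ fun ω => ?_)
        simp only; ring
      · exact key hpu huv
    have h4 : ∫ ω, (W r ω - W p ω) * (W q ω - W p ω) * Z ω ∂P
        = ((min r q : Icc (0 : ℝ) T) - (p : ℝ)) * ∫ ω, Z ω ∂P := by
      rcases le_total r q with h | h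
      · rw [min_eq_left h, h2 hpr h]
      · rw [min_eq_right h, ← h2 hpq h]
        congr 1; ext ω; ring
    have h5 : (p : ℝ) ≤ ((min r q : Icc (0 : ℝ) T) : ℝ) := le_min hpr hpq
    rw [max_eq_right (by linarith), ← h4, ← zero_add (∫ ω, (W r ω - W p ω) * _ * Z ω ∂P), ← h1,
      ← integral_add (key hlp hpq) (key hpr hpq)]
    congr 1; ext ω; ring

/-- If `t ≤ p`, the later term has not started and both sides vanish. Otherwise this is
`integral_term_mul_term` with right end points stopped at `t`. -/
lemma integral_elementary_mul (hW : IsBrownianMotion P 𝓕 W) (t : Icc (0 : ℝ) T)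
    {l r p q : Icc (0 : ℝ) T} (hlp : l ≤ p) (hpq : p ≤ q) {ζ η : Ω → ℝ}
    (hζ : StronglyMeasurable[𝓕 l] ζ) (hη : StronglyMeasurable[𝓕 p] η)
    {C D : ℝ} (hC : ∀ ω, ‖ζ ω‖ ≤ C) (hD : ∀ ω, ‖η ω‖ ≤ D) :
    ∫ ω, ((W (min t r) ω - W (min t l) ω) * ζ ω) * ((W (min t q) ω - W (min t p) ω) * η ω) ∂P
      = ∫ ω, ∫ s in Iic t, (Ioc l r).indicator (fun _ => ζ ω) s *
          (Ioc p q).indicator (fun _ => η ω) s ∂(lebesgue T) ∂P := by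
  have hset : Iic t ∩ (Ioc l r ∩ Ioc p q) = Ioc p (min t (min r q)) := by
    ext s; simp only [mem_inter_iff, mem_Iic, mem_Ioc, le_min_iff]
    constructor
    · rintro ⟨a, ⟨b, c⟩, d, e⟩; exact ⟨d, a, c, e⟩
    · rintro ⟨a, b, c, d⟩; exact ⟨b, ⟨hlp.trans_lt a, c⟩, a, d⟩
  have hR : ∀ ω, ∫ s in Iic t, (Ioc l r).indicator (fun _ => ζ ω) s *
      (Ioc p q).indicator (fun _ => η ω) s ∂(lebesgue T)
      = max 0 (((min t (min r q) : Icc (0 : ℝ) T) : ℝ) - p) * (ζ ω * η ω) := by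
    intro ω
    have : ∀ s, (Ioc l r).indicator (fun _ => ζ ω) s * (Ioc p q).indicator (fun _ => η ω) s
        = (Ioc l r ∩ Ioc p q).indicator (fun _ => ζ ω * η ω) s := by
      intro s; rw [inter_indicator_mul]
    simp_rw [this]
    rw [setIntegral_indicator (measurableSet_Ioc.inter measurableSet_Ioc), hset,
      setIntegral_const, Measure.real, lebesgue_Ioc, ENNReal.toReal_ofReal', max_comm, smul_eq_mul]
  simp_rw [hR]
  rw [integral_const_mul]
  rcases le_total t p with htp | hpt
  · have h1 : ((min t (min r q) : Icc (0 : ℝ) T) : ℝ) ≤ p := (min_le_left t _).trans htp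
    rw [max_eq_left (by linarith), zero_mul]
    simp [min_eq_left htp, min_eq_left (htp.trans hpq)]
  · rw [min_eq_right hpt, min_eq_right (hlp.trans hpt)]
    have h := hW.integral_term_mul_term (r := min t r) (q := min t q) hlp
      (le_min hpt hpq) ((hζ.mono (𝓕.mono hlp)).mul hη) (C := C * D)
      (fun ω => by
        rw [Pi.mul_apply, norm_mul]
        exact mul_le_mul (hC ω) (hD ω) (norm_nonneg _) ((norm_nonneg _).trans (hC ω)))
    have h2 : min (min t r) (min t q) = min t (min r q) := by
      rw [min_min_min_comm, min_self]
    rw [h2] at h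
    simp only [Pi.mul_apply] at h
    rw [← h]
    congr 1; ext ω; ring

/-- The Itô isometry for elementary integrands. -/
lemma integral_elementary_sq (hW : IsBrownianMotion P 𝓕 W) [IsProbabilityMeasure P]
    (t : Icc (0 : ℝ) T)
    {ι : Type*} [Fintype ι] (l r : ι → Icc (0 : ℝ) T) (hlr : ∀ i, l i ≤ r i) (ζ : ι → Ω → ℝ)
    (hζ : ∀ i, StronglyMeasurable[𝓕 (l i)] (ζ i)) (hb : ∀ i, ∃ C : ℝ, ∀ ω, ‖ζ i ω‖ ≤ C) :
    ∫⁻ ω, ‖∑ i, (W (min t (r i)) ω - W (min t (l i)) ω) * ζ i ω‖ₑ ^ 2 ∂P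
      = ∫⁻ ω, ∫⁻ s in Iic t, ‖∑ i, (Ioc (l i) (r i)).indicator (fun _ => ζ i ω) s‖ₑ ^ 2
          ∂(lebesgue T) ∂P := by
  choose C hC using hb
  have hsq : ∀ x : ℝ, ‖x‖ₑ ^ 2 = ENNReal.ofReal (x ^ 2) := by
    intro x
    rw [← enorm_pow, Real.enorm_of_nonneg (sq_nonneg x)]
  have hζm : ∀ i, StronglyMeasurable (ζ i) := fun i => (hζ i).mono (𝓕.le _)
  have hterm : ∀ i, MemLp (fun ω => (W (min t (r i)) ω - W (min t (l i)) ω) * ζ i ω) 2 P := by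
    intro i
    have := (MemLp.of_bound (p := ⊤) (hζm i).aestronglyMeasurable (C i) (ae_of_all _ (hC i)) :
      MemLp (ζ i) ⊤ P)
    exact this.mul' (hW.memLp_sub (min_le_min_left t (hlr i)))
  have hterms : MemLp (fun ω => ∑ i, (W (min t (r i)) ω - W (min t (l i)) ω) * ζ i ω) 2 P :=
    memLp_finsetSum _ fun i _ => hterm i
  have hjm : ∀ i, Measurable fun z : Ω × Icc (0 : ℝ) T =>
      (Ioc (l i) (r i)).indicator (fun _ => ζ i z.1) z.2 := by
    intro i
    have h1 : (fun z : Ω × Icc (0 : ℝ) T => (Ioc (l i) (r i)).indicator (fun _ => ζ i z.1) z.2)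
        = (univ ×ˢ Ioc (l i) (r i)).indicator (fun z => ζ i z.1) := by
      ext z; simp [indicator]
    rw [h1]
    exact ((hζm i).measurable.comp measurable_fst).indicator
      (MeasurableSet.univ.prod measurableSet_Ioc)
  have hjb : ∀ i ω s, ‖(Ioc (l i) (r i)).indicator (fun _ => ζ i ω) s‖ ≤ C i := by
    intro i ω s
    exact (norm_indicator_le_norm_self _ _).trans (hC i ω)
  have hprod : ∀ i j, Integrable (fun z : Ω × Icc (0 : ℝ) T =>
      (Ioc (l i) (r i)).indicator (fun _ => ζ i z.1) z.2 *
      (Ioc (l j) (r j)).indicator (fun _ => ζ j z.1) z.2)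
      (P.prod ((lebesgue T).restrict (Iic t))) := by
    intro i j
    refine Integrable.of_bound ((hjm i).mul (hjm j)).aestronglyMeasurable (C i * C j)
      (ae_of_all _ fun z => ?_)
    rw [norm_mul]
    exact mul_le_mul (hjb _ _ _) (hjb _ _ _) (norm_nonneg _) ((norm_nonneg _).trans (hjb i z.1 z.2))
  have hpair : ∀ i j, ∫ ω, ((W (min t (r i)) ω - W (min t (l i)) ω) * ζ i ω) *
      ((W (min t (r j)) ω - W (min t (l j)) ω) * ζ j ω) ∂P
      = ∫ ω, ∫ s in Iic t, (Ioc (l i) (r i)).indicator (fun _ => ζ i ω) s *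
          (Ioc (l j) (r j)).indicator (fun _ => ζ j ω) s ∂(lebesgue T) ∂P := by
    intro i j
    rcases le_total (l i) (l j) with h | h
    · exact hW.integral_elementary_mul (r := r i) t h (hlr j) (hζ i) (hζ j) (hC i) (hC j)
    · have := hW.integral_elementary_mul (r := r j) t h (hlr i) (hζ j) (hζ i) (hC j) (hC i)
      convert this using 1
      · congr 1; ext ω; ring
      · congr 1; ext ω; congr 1; ext s; ring
  simp_rw [hsq]
  have hval_meas : Measurable fun z : Ω × Icc (0 : ℝ) T =>
      ∑ i, (Ioc (l i) (r i)).indicator (fun _ => ζ i z.1) z.2 :=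
    Finset.measurable_sum _ fun i _ => hjm i
  rw [← lintegral_prod (μ := P) (ν := (lebesgue T).restrict (Iic t))
    (fun z : Ω × Icc (0 : ℝ) T => ENNReal.ofReal
      ((∑ i, (Ioc (l i) (r i)).indicator (fun _ => ζ i z.1) z.2) ^ 2))
      ((hval_meas.pow_const 2).ennreal_ofReal.aemeasurable),
    ← ofReal_integral_eq_lintegral_ofReal hterms.integrable_sq (ae_of_all _ fun _ => sq_nonneg _)]
  have hterm2 : ∀ i j, Integrable (fun ω => ((W (min t (r i)) ω - W (min t (l i)) ω) * ζ i ω) *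
      ((W (min t (r j)) ω - W (min t (l j)) ω) * ζ j ω)) P := fun i j =>
    (hterm i).integrable_mul (hterm j)
  have hexp : ∀ x : ι → ℝ, (∑ i, x i) ^ 2 = ∑ i, ∑ j, x i * x j := by
    intro x; rw [sq, Finset.sum_mul_sum]
  have hint2 : Integrable (fun z : Ω × Icc (0 : ℝ) T =>
      (∑ i, (Ioc (l i) (r i)).indicator (fun _ => ζ i z.1) z.2) ^ 2)
      (P.prod ((lebesgue T).restrict (Iic t))) := by
    simp_rw [hexp]
    exact integrable_finsetSum _ fun i _ => integrable_finsetSum _ fun j _ => hprod i j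
  rw [← ofReal_integral_eq_lintegral_ofReal hint2 (ae_of_all _ fun _ => sq_nonneg _)]
  congr 1
  simp_rw [hexp]
  rw [integral_finsetSum _ fun i _ => integrable_finsetSum _ fun j _ => hterm2 i j,
    integral_finsetSum _ fun i _ => integrable_finsetSum _ fun j _ => hprod i j]
  refine Finset.sum_congr rfl fun i _ => ?_
  rw [integral_finsetSum _ fun j _ => hterm2 i j, integral_finsetSum _ fun j _ => hprod i j]
  refine Finset.sum_congr rfl fun j _ => ?_
  rw [integral_prod _ (hprod i j), ← hpair i j]

/-- Induction on the largest index: the latest increment is independent of the σ-algebra at its left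
end point, and all earlier increments are measurable there. -/
lemma iIndepFun_increments (hW : IsBrownianMotion P 𝓕 W) [IsProbabilityMeasure P]
    {t : ℕ → Icc (0 : ℝ) T} (ht : Monotone t) :
    iIndepFun (fun i ω => W (t (i + 1)) ω - W (t i) ω) P := by
  rw [iIndepFun_iff_measure_inter_preimage_eq_mul]
  intro S
  induction S using Finset.induction_on_max with
  | empty => intro sets _; simp
  | insert a S ha ih =>
    intro sets hs
    have ha' : a ∉ S := fun h => lt_irrefl _ (ha a h)
    rw [Finset.set_biInter_insert, Finset.prod_insert ha',
      ← ih fun i hi => hs i (Finset.mem_insert_of_mem hi)]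
    refine (Indep_iff _ _ _).1 (hW.increment_indep (t a) (t (a + 1)) (ht a.le_succ)) _ _
      ⟨sets a, hs a (Finset.mem_insert_self _ _), rfl⟩ ?_
    refine Finset.measurableSet_biInter _ fun i hi => ?_
    have h1 : StronglyMeasurable[𝓕 (t a)] fun ω => W (t (i + 1)) ω - W (t i) ω :=
      ((hW.adapted _).mono (𝓕.mono (ht (ha i hi)))).sub
        ((hW.adapted _).mono (𝓕.mono (ht (ha i hi).le)))
    exact h1.measurable (hs i (Finset.mem_insert_of_mem hi))

end IsBrownianMotion

end Brownian

/-! ### Step functions on uniform partitions and Riemann-Stieltjes sums -/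

section Partition

variable {T : ℝ}

/-- The points `i T / (n + 1)` of the uniform partition of `[0, T]`. -/
noncomputable def node (hT : 0 ≤ T) (n i : ℕ) : Icc (0 : ℝ) T :=
  projIcc 0 T hT (i * T / (n + 1))

lemma node_mono (hT : 0 ≤ T) (n : ℕ) : Monotone (node hT n) := fun i j hij =>
  monotone_projIcc hT (by gcongr)

lemma node_zero (hT : 0 ≤ T) (n : ℕ) : node hT n 0 = ⟨0, left_mem_Icc.2 hT⟩ := by
  simp [node, projIcc_left]

lemma coe_node (hT : 0 ≤ T) {n i : ℕ} (hi : i ≤ n + 1) :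
    (node hT n i : ℝ) = i * T / (n + 1) := by
  have h1 : (i : ℝ) ≤ n + 1 := by exact_mod_cast hi
  have h2 : i * T / (n + 1) ∈ Icc 0 T := by
    refine ⟨by positivity, ?_⟩
    rw [div_le_iff₀ (by positivity)]
    nlinarith
  rw [node, projIcc_of_mem hT h2]

lemma node_last (hT : 0 ≤ T) (n : ℕ) : node hT n (n + 1) = ⟨T, right_mem_Icc.2 hT⟩ := by
  apply Subtype.ext
  rw [coe_node hT le_rfl]
  push_cast
  field_simp

lemma coe_node_succ_sub (hT : 0 ≤ T) {n i : ℕ} (hi : i < n + 1) :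
    (node hT n (i + 1) : ℝ) - node hT n i = T / (n + 1) := by
  rw [coe_node hT hi, coe_node hT hi.le]
  push_cast
  ring

/-- The step function with value `f (i T / (n + 1))` on the `i`-th interval of the partition. -/
noncomputable def step (hT : 0 ≤ T) (f : ℝ → ℝ) (n : ℕ) (s : Icc (0 : ℝ) T) : ℝ :=
  ∑ i : Fin (n + 1), (Ioc (node hT n i) (node hT n (i + 1))).indicator
    (fun _ => f (node hT n i)) s

lemma measurable_step (hT : 0 ≤ T) (f : ℝ → ℝ) (n : ℕ) : Measurable (step hT f n) :=
  Finset.measurable_sum _ fun _ _ => measurable_const.indicator measurableSet_Ioc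

/-- The half-open intervals cover every point except `0`, where the step function is `0` whatever
`f` is. This is why positivity of `s`, or an almost-everywhere statement, appears below. -/
lemma exists_step_eq (hT : 0 ≤ T) (f : ℝ → ℝ) (n : ℕ) {s : Icc (0 : ℝ) T} (hs : 0 < (s : ℝ)) :
    ∃ x : Icc (0 : ℝ) T, step hT f n s = f x ∧ |(x : ℝ) - s| ≤ T / (n + 1) := by
  classical
  have hex : ∃ k, s ≤ node hT n k := ⟨n + 1, by rw [node_last]; exact s.2.2⟩
  obtain ⟨k, hk, hmin⟩ : ∃ k, s ≤ node hT n k ∧ ∀ j < k, ¬ s ≤ node hT n j :=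
    ⟨Nat.find hex, Nat.find_spec hex, fun j hj => Nat.find_min hex hj⟩
  have hk0 : k ≠ 0 := by
    rintro rfl
    rw [node_zero] at hk
    exact absurd hk (not_le.2 hs)
  obtain ⟨i, rfl⟩ := Nat.exists_eq_succ_of_ne_zero hk0
  have hi : node hT n i < s := not_le.1 (hmin i i.lt_succ_self)
  have hin : i < n + 1 := by
    by_contra h
    have := node_mono hT n (not_lt.1 h)
    rw [node_last] at this
    exact absurd (this.trans_lt hi) (not_lt.2 s.2.2)
  refine ⟨node hT n i, ?_, ?_⟩
  · rw [step, Finset.sum_eq_single (⟨i, hin⟩ : Fin (n + 1))]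
    · rw [indicator_of_mem]
      exact ⟨hi, hk⟩
    · intro j _ hj
      rw [indicator_of_notMem]
      rintro ⟨h1, h2⟩
      rcases lt_or_gt_of_ne (fun h => hj (Fin.ext h) : (j : ℕ) ≠ i) with h | h
      · exact absurd (h2.trans (node_mono hT n h)) (not_le.2 hi)
      · exact absurd (hk.trans (node_mono hT n h)) (not_le.2 h1)
    · simp
  · have h1 : (node hT n i : ℝ) < s := hi
    have h2 : (s : ℝ) ≤ node hT n (i + 1) := hk
    rw [abs_sub_comm, abs_of_pos (by linarith), ← coe_node_succ_sub hT hin]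
    linarith

lemma ae_pos (hT : 0 ≤ T) : ∀ᵐ s : Icc (0 : ℝ) T ∂(lebesgue T), 0 < (s : ℝ) := by
  have h : {s : Icc (0 : ℝ) T | ¬ 0 < (s : ℝ)} = {⟨0, left_mem_Icc.2 hT⟩} := by
    ext s
    simp only [mem_ofPred_eq, not_lt, mem_singleton_iff, Subtype.ext_iff]
    exact ⟨fun h => le_antisymm h s.2.1, fun h => h.le⟩
  rw [ae_iff, h, lebesgue, comap_subtype_coe_apply measurableSet_Icc]
  simp

lemma tendsto_step (hT : 0 ≤ T) {f : ℝ → ℝ} (hf : Continuous f) {s : Icc (0 : ℝ) T}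
    (hs : 0 < (s : ℝ)) : Tendsto (fun n => step hT f n s) atTop (𝓝 (f s)) := by
  choose x hx hxs using fun n => exists_step_eq hT f n hs
  simp_rw [hx]
  refine (hf.tendsto _).comp ?_
  rw [tendsto_iff_dist_tendsto_zero]
  refine squeeze_zero (fun _ => dist_nonneg) (fun n => hxs n) ?_
  simpa using (tendsto_one_div_add_atTop_nhds_zero_nat (𝕜 := ℝ)).const_mul T |>.congr
    fun n => by ring

lemma abs_step_le (hT : 0 ≤ T) {f : ℝ → ℝ} {C : ℝ} (hC : ∀ x, |f x| ≤ C) (n : ℕ) {s : Icc (0 : ℝ) T}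
    (hs : 0 < (s : ℝ)) : |step hT f n s| ≤ C := by
  obtain ⟨x, hx, -⟩ := exists_step_eq hT f n hs
  rw [hx]; exact hC x

lemma tendsto_lintegral_step (hT : 0 ≤ T) {f : ℝ → ℝ} (hf : Continuous f) {C : ℝ}
    (hC : ∀ x, |f x| ≤ C) (t : Icc (0 : ℝ) T) :
    Tendsto (fun n => ∫⁻ s in Iic t, ‖step hT f n s - f s‖ₑ ^ 2 ∂(lebesgue T)) atTop (𝓝 0) := by
  have h0 : ∫⁻ _ in Iic t, (0 : ℝ≥0∞) ∂(lebesgue T) = 0 := by simp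
  rw [← h0]
  have hpos := ae_restrict_of_ae (s := Iic t) (ae_pos hT)
  refine tendsto_lintegral_of_dominated_convergence (fun _ => ‖2 * C‖ₑ ^ 2) (fun n => ?_)
    (fun n => ?_) ?_ ?_
  · exact (((measurable_step hT f n).sub (hf.measurable.comp measurable_subtype_coe)).enorm).pow_const 2
  · filter_upwards [hpos] with s hs
    gcongr
    rw [enorm_le_iff_norm_le, Real.norm_eq_abs, Real.norm_eq_abs]
    refine (abs_sub _ _).trans (le_trans ?_ (le_abs_self _))
    linarith [abs_step_le hT hC n hs, hC s]
  · rw [lintegral_const]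
    finiteness
  · filter_upwards [hpos] with s hs
    have h1 : Tendsto (fun n => step hT f n s - f s) atTop (𝓝 0) := by
      simpa using (tendsto_step hT hf hs).sub_const (f s)
    have h2 := (ENNReal.continuous_pow 2).tendsto _ |>.comp ((continuous_enorm.tendsto _).comp h1)
    simpa [Function.comp_def] using h2

lemma integral_lebesgue_eq (hT : 0 ≤ T) (φ : Icc (0 : ℝ) T → ℝ) (t : Icc (0 : ℝ) T) :
    ∫ s in Iic t, φ s ∂(lebesgue T) = ∫ s in (0 : ℝ)..t, IccExtend hT φ s := by
  rw [intervalIntegral.integral_of_le t.2.1, ← integral_Icc_eq_integral_Ioc]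
  have h1 : ∫ s in Iic t, φ s ∂(lebesgue T)
      = ∫ s : Icc (0 : ℝ) T, (Icc 0 (t : ℝ)).indicator (IccExtend hT φ) s ∂(lebesgue T) := by
    rw [← integral_indicator measurableSet_Iic]
    congr 1; ext s
    by_cases h : s ≤ t
    · rw [indicator_of_mem (show s ∈ Iic t from h), indicator_of_mem, IccExtend_val]
      exact ⟨s.2.1, h⟩
    · rw [indicator_of_notMem (show s ∉ Iic t from h), indicator_of_notMem]
      exact fun h' => h h'.2
  rw [h1, lebesgue, integral_subtype_comap measurableSet_Icc
    (fun s => (Icc 0 (t : ℝ)).indicator (IccExtend hT φ) s), setIntegral_indicator measurableSet_Icc,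
    inter_eq_right.2 (Icc_subset_Icc_right t.2.2)]

lemma integral_lebesgue_univ_eq (hT : 0 ≤ T) (φ : Icc (0 : ℝ) T → ℝ) :
    ∫ s, φ s ∂(lebesgue T) = ∫ s in (0 : ℝ)..T, IccExtend hT φ s := by
  have := integral_lebesgue_eq hT φ ⟨T, right_mem_Icc.2 hT⟩
  rw [← this]
  have h : Iic (⟨T, right_mem_Icc.2 hT⟩ : Icc (0 : ℝ) T) = univ :=
    eq_univ_of_forall fun s => s.2.2
  rw [h, Measure.restrict_univ]

/-- Riemann-Stieltjes sums of a smooth function against a continuous one converge, by summation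
by parts. -/
lemma tendsto_sum_mul_sub (hT : 0 ≤ T) {f g : ℝ → ℝ} (hfg : ∀ x, HasDerivAt f (-g x) x)
    (hg : Continuous g) {w : Icc (0 : ℝ) T → ℝ} (hw : Continuous w) :
    Tendsto (fun n => ∑ i : Fin (n + 1), (w (node hT n (i + 1)) - w (node hT n i)) * f (node hT n i))
      atTop (𝓝 (f T * w ⟨T, right_mem_Icc.2 hT⟩ - f 0 * w ⟨0, left_mem_Icc.2 hT⟩
        + ∫ s, g s * w s ∂(lebesgue T))) := by
  set W := IccExtend hT w with hWdef
  have hW : Continuous W := hw.Icc_extend'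
  have hWn : ∀ x : Icc (0 : ℝ) T, W x = w x := fun x => IccExtend_val hT w x
  have hint : ∫ s, g s * w s ∂(lebesgue T) = ∫ s in (0 : ℝ)..T, g s * W s := by
    rw [integral_lebesgue_univ_eq hT]
    refine intervalIntegral.integral_congr fun s hs => ?_
    rw [uIcc_of_le hT] at hs
    simp only [hWdef, IccExtend_of_mem hT _ hs]
  -- Abel summation, with each increment of `f` written as an integral of `-g`. What remains is to
  -- replace `w` at the right node by `w s` under the integral.
  have hparts : ∀ n N : ℕ, ∑ i ∈ Finset.range N, (w (node hT n (i + 1)) - w (node hT n i)) *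
      f (node hT n i) = f (node hT n N) * w (node hT n N) - f (node hT n 0) * w (node hT n 0)
        + ∑ i ∈ Finset.range N, ∫ s in (node hT n i : ℝ)..(node hT n (i + 1)),
          g s * W (node hT n (i + 1)) := by
    intro n N
    induction N with
    | zero => simp
    | succ N ih =>
      rw [Finset.sum_range_succ, ih, Finset.sum_range_succ, intervalIntegral.integral_mul_const]
      have : ∫ s in (node hT n N : ℝ)..(node hT n (N + 1)), g s
          = - (f (node hT n (N + 1)) - f (node hT n N)) := by
        rw [← intervalIntegral.integral_eq_sub_of_hasDerivAt (fun x _ => hfg x)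
          (hg.neg.intervalIntegrable _ _), intervalIntegral.integral_neg, neg_neg]
      rw [this, hWn]
      ring
  have hsplit : ∀ n : ℕ, ∑ i ∈ Finset.range (n + 1),
      ∫ s in (node hT n i : ℝ)..(node hT n (i + 1)), g s * W s = ∫ s in (0 : ℝ)..T, g s * W s := by
    intro n
    rw [intervalIntegral.sum_integral_adjacent_intervals (f := fun s => g s * W s)
      (a := fun i => (node hT n i : ℝ)) fun k _ => (hg.mul hW).intervalIntegrable _ _,
      node_zero, node_last]
  obtain ⟨C, hC⟩ : ∃ C, ∀ x ∈ Icc 0 T, ‖g x‖ ≤ C :=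
    isCompact_Icc.exists_bound_of_continuousOn hg.continuousOn
  have hC0 : 0 ≤ C := (norm_nonneg _).trans (hC 0 (left_mem_Icc.2 hT))
  have huc : UniformContinuous W := by
    have := (CompactSpace.uniformContinuous_of_continuous hw)
    exact this.comp (LipschitzWith.projIcc hT).uniformContinuous
  simp_rw [fun n => Fin.sum_univ_eq_sum_range
    (fun i => (w (node hT n (i + 1)) - w (node hT n i)) * f (node hT n i)) (n + 1), hparts,
    node_zero, node_last]
  refine tendsto_const_nhds.add ?_
  rw [hint, Metric.tendsto_atTop]
  intro ε hε
  -- The total error is `C * T` times this modulus; the `+ 1` avoids division by zero and makes the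
  -- final inequality strict.
  obtain ⟨η, hη, hηW⟩ := Metric.uniformContinuous_iff.1 huc (ε / (C * T + 1)) (by positivity)
  obtain ⟨n₀, hn₀⟩ := exists_nat_gt (T / η)
  refine ⟨n₀, fun n hn => ?_⟩
  have hstep : T / (n + 1) < η := by
    rw [div_lt_iff₀ (by positivity)]
    rw [div_lt_iff₀ hη] at hn₀
    have : (n₀ : ℝ) ≤ n := by exact_mod_cast hn
    nlinarith
  rw [← hsplit n, Real.dist_eq, ← Finset.sum_sub_distrib]
  have hterm : ∀ i ∈ Finset.range (n + 1),
      |(∫ s in (node hT n i : ℝ)..(node hT n (i + 1)), g s * W (node hT n (i + 1)))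
        - ∫ s in (node hT n i : ℝ)..(node hT n (i + 1)), g s * W s|
      ≤ C * (ε / (C * T + 1)) * (T / (n + 1)) := by
    intro i hi
    have hi' := Finset.mem_range.1 hi
    have hle : (node hT n i : ℝ) ≤ node hT n (i + 1) := node_mono hT n i.le_succ
    rw [← intervalIntegral.integral_sub (f := fun s => g s * W (node hT n (i + 1)))
      (g := fun s => g s * W s) ((hg.mul continuous_const).intervalIntegrable _ _)
      ((hg.mul hW).intervalIntegrable _ _), ← Real.norm_eq_abs]
    refine (intervalIntegral.norm_integral_le_of_norm_le_const
      (C := C * (ε / (C * T + 1))) fun s hs => ?_).trans ?_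
    · rw [uIoc_of_le hle] at hs
      have hs' : s ∈ Icc 0 T := ⟨(node hT n i).2.1.trans hs.1.le, hs.2.trans (node hT n (i + 1)).2.2⟩
      rw [← mul_sub, norm_mul]
      refine mul_le_mul (hC s hs') ?_ (norm_nonneg _) hC0
      rw [← dist_eq_norm]
      refine (hηW ?_).le
      rw [Real.dist_eq, abs_of_nonneg (by linarith [hs.2])]
      linarith [coe_node_succ_sub hT hi', hs.1]
    · rw [coe_node_succ_sub hT hi', abs_of_nonneg (by positivity)]
  refine (Finset.abs_sum_le_sum_abs _ _).trans_lt ((Finset.sum_le_sum hterm).trans_lt ?_)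
  rw [Finset.sum_const, Finset.card_range, nsmul_eq_mul]
  push_cast
  have : (n + 1 : ℝ) * (C * (ε / (C * T + 1)) * (T / (n + 1))) = ε * (C * T / (C * T + 1)) := by
    field_simp
  rw [this]
  have h1 : C * T / (C * T + 1) < 1 := by
    rw [div_lt_one (by positivity)]
    linarith
  nlinarith

end Partition

/-! ### Itô integrals with a deterministic coordinate -/

lemma enorm_sub_sq_le (a b c : ℝ) : ‖a - c‖ₑ ^ 2 ≤ 2 * ‖a - b‖ₑ ^ 2 + 2 * ‖b - c‖ₑ ^ 2 := by
  have hsq : ∀ x : ℝ, ‖x‖ₑ ^ 2 = ENNReal.ofReal (x ^ 2) := fun x => by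
    rw [← enorm_pow, Real.enorm_of_nonneg (sq_nonneg x)]
  have h2 : (2 : ℝ≥0∞) = ENNReal.ofReal 2 := by simp
  rw [hsq, hsq, hsq, h2, ← ENNReal.ofReal_mul zero_le_two, ← ENNReal.ofReal_mul zero_le_two,
    ← ENNReal.ofReal_add (by positivity) (by positivity)]
  apply ENNReal.ofReal_le_ofReal
  nlinarith [sq_nonneg (a - b - (b - c))]

/-- If the integrand of an Itô integral has a deterministic coordinate, then this coordinate of
the integral is the limit of the Wiener integrals of deterministic step functions. -/
lemma IsItoIntegral.tendsto_coord {Ω : Type*} {mΩ : MeasurableSpace Ω} {T : ℝ} {P : Measure Ω}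
    [IsProbabilityMeasure P] {𝓕 : Filtration (Icc (0 : ℝ) T) mΩ} {W : Icc (0 : ℝ) T → Ω → ℝ}
    (hW : IsBrownianMotion P 𝓕 W) {d : ℕ} {H : Icc (0 : ℝ) T → Ω → EuclideanSpace ℝ (Fin d)}
    {t : Icc (0 : ℝ) T} {I : Ω → EuclideanSpace ℝ (Fin d)} (hI : IsItoIntegral P 𝓕 W H t I)
    (j : Fin d) {φ : Icc (0 : ℝ) T → ℝ} (hφ : Measurable φ)
    (hH : ∀ᵐ ω ∂P, ∀ s ≤ t, H s ω j = φ s)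
    {m : ℕ → ℕ} {l r : ∀ n, Fin (m n) → Icc (0 : ℝ) T} (hlr : ∀ n i, l n i ≤ r n i)
    {c : ∀ n, Fin (m n) → ℝ}
    (hc : Tendsto (fun n => ∫⁻ s in Iic t,
      ‖∑ i, (Ioc (l n i) (r n i)).indicator (fun _ => c n i) s - φ s‖ₑ ^ 2 ∂(lebesgue T))
      atTop (𝓝 0)) :
    Tendsto (fun n => ∫⁻ ω,
      ‖∑ i, (W (min t (r n i)) ω - W (min t (l n i)) ω) * c n i - I ω j‖ₑ ^ 2 ∂P) atTop (𝓝 0) := by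
  obtain ⟨S, hS1, hS2⟩ := hI.limit
  have hcoord : ∀ x : EuclideanSpace ℝ (Fin d), ‖x j‖ₑ ≤ ‖x‖ₑ := fun x => by
    rw [enorm_le_iff_norm_le]; exact PiLp.norm_apply_le x j
  set Q : ℕ → Icc (0 : ℝ) T → ℝ := fun n s =>
    ∑ i, (Ioc (l n i) (r n i)).indicator (fun _ => c n i) s with hQ
  set QI : ℕ → Ω → ℝ := fun n ω =>
    ∑ i, (W (min t (r n i)) ω - W (min t (l n i)) ω) * c n i with hQI
  have hQm : ∀ n, Measurable (Q n) := fun n =>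
    Finset.measurable_sum _ fun _ _ => measurable_const.indicator measurableSet_Ioc
  have hval : ∀ n s ω, (S n).val s ω j = ∑ i, (Ioc ((S n).left i) ((S n).right i)).indicator
      (fun _ => (S n).coef i ω j) s := by
    intro n s ω
    rw [SimpleProcess.val, WithLp.ofLp_sum, Finset.sum_apply]
    refine Finset.sum_congr rfl fun i _ => ?_
    by_cases h : s ∈ Ioc ((S n).left i) ((S n).right i)
    · rw [indicator_of_mem h, indicator_of_mem h]
    · rw [indicator_of_notMem h, indicator_of_notMem h]; rfl
  have hint : ∀ n ω, (S n).integral W t ω j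
      = ∑ i, (W (min t ((S n).right i)) ω - W (min t ((S n).left i)) ω) * (S n).coef i ω j := by
    intro n ω
    rw [SimpleProcess.integral, WithLp.ofLp_sum, Finset.sum_apply]
    rfl
  have hcm : ∀ n i, StronglyMeasurable[𝓕 ((S n).left i)] fun ω => (S n).coef i ω j := fun n i =>
    (PiLp.continuous_apply 2 _ j).comp_stronglyMeasurable ((S n).coef_measurable i)
  have hiso : ∀ n, ∫⁻ ω, ‖QI n ω - (S n).integral W t ω j‖ₑ ^ 2 ∂P
      = ∫⁻ ω, ∫⁻ s in Iic t, ‖Q n s - (S n).val s ω j‖ₑ ^ 2 ∂(lebesgue T) ∂P := by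
    intro n
    -- The difference of two elementary integrals is again elementary, over the disjoint union of
    -- the index sets and with the second family negated.
    have := hW.integral_elementary_sq t (ι := Fin (m n) ⊕ Fin (S n).size)
      (Sum.elim (l n) (S n).left) (Sum.elim (r n) (S n).right)
      (by rintro (i | i); exacts [hlr n i, (S n).left_le_right i])
      (Sum.elim (fun i _ => c n i) (fun i ω => -(S n).coef i ω j))
      (by rintro (i | i); exacts [stronglyMeasurable_const, (hcm n i).neg])
      (by
        rintro (i | i)
        · exact ⟨‖c n i‖, fun _ => le_rfl⟩
        · obtain ⟨C, hC⟩ := (S n).coef_bounded i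
          refine ⟨C, fun ω => ?_⟩
          simp only [Sum.elim_inr, norm_neg]
          exact (PiLp.norm_apply_le _ j).trans (hC ω))
    simp only [Fintype.sum_sum_type, Sum.elim_inl, Sum.elim_inr, mul_neg,
      Finset.sum_neg_distrib, indicator_neg, ← sub_eq_add_neg, ← hint] at this
    rw [this]
    simp only [hval, hQ]
  have hIoc : ∀ n, ∫⁻ ω, ∫⁻ s in Iic t, ‖Q n s - (S n).val s ω j‖ₑ ^ 2 ∂(lebesgue T) ∂P
      ≤ 2 * (∫⁻ s in Iic t, ‖Q n s - φ s‖ₑ ^ 2 ∂(lebesgue T))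
        + 2 * ∫⁻ ω, (∫⁻ s in Iic t, ‖(S n).val s ω - H s ω‖ₑ ^ 2 ∂(lebesgue T)) ∂P := by
    intro n
    have h1 : ∀ᵐ ω ∂P, ∫⁻ s in Iic t, ‖Q n s - (S n).val s ω j‖ₑ ^ 2 ∂(lebesgue T)
        ≤ 2 * (∫⁻ s in Iic t, ‖Q n s - φ s‖ₑ ^ 2 ∂(lebesgue T))
          + 2 * ∫⁻ s in Iic t, ‖(S n).val s ω - H s ω‖ₑ ^ 2 ∂(lebesgue T) := by
      filter_upwards [hH] with ω hω
      rw [← lintegral_const_mul' _ _ (by simp), ← lintegral_const_mul' _ _ (by simp),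
        ← lintegral_add_left (f := fun s => 2 * ‖Q n s - φ s‖ₑ ^ 2)
          (((((hQm n).sub hφ).enorm).pow_const 2).const_mul 2)]
      refine setLIntegral_mono' measurableSet_Iic fun s hs => ?_
      refine (enorm_sub_sq_le _ (φ s) _).trans ?_
      gcongr
      rw [← hω s hs, ← enorm_neg, neg_sub]
      exact hcoord ((S n).val s ω - H s ω)
    refine (lintegral_mono_ae h1).trans ?_
    rw [lintegral_add_left measurable_const, lintegral_const, measure_univ, mul_one,
      lintegral_const_mul' _ _ (by simp)]
  have hbound : ∀ n, ∫⁻ ω, ‖QI n ω - I ω j‖ₑ ^ 2 ∂P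
      ≤ 2 * (2 * (∫⁻ s in Iic t, ‖Q n s - φ s‖ₑ ^ 2 ∂(lebesgue T))
        + 2 * ∫⁻ ω, (∫⁻ s in Iic t, ‖(S n).val s ω - H s ω‖ₑ ^ 2 ∂(lebesgue T)) ∂P)
        + 2 * ∫⁻ ω, ‖(S n).integral W t ω - I ω‖ₑ ^ 2 ∂P := by
    intro n
    have hm : Measurable fun ω => QI n ω - (S n).integral W t ω j := by
      simp only [hint]
      refine (Finset.measurable_sum _ fun i _ => ?_).sub (Finset.measurable_sum _ fun i _ => ?_)
      · exact ((hW.measurable _).sub (hW.measurable _)).mul_const _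
      · exact ((hW.measurable _).sub (hW.measurable _)).mul ((hcm n i).mono (𝓕.le _)).measurable
    calc ∫⁻ ω, ‖QI n ω - I ω j‖ₑ ^ 2 ∂P
        ≤ ∫⁻ ω, (2 * ‖QI n ω - (S n).integral W t ω j‖ₑ ^ 2
            + 2 * ‖(S n).integral W t ω - I ω‖ₑ ^ 2) ∂P := by
          refine lintegral_mono fun ω => (enorm_sub_sq_le _ ((S n).integral W t ω j) _).trans ?_
          gcongr
          exact hcoord ((S n).integral W t ω - I ω)
      _ = 2 * (∫⁻ ω, ‖QI n ω - (S n).integral W t ω j‖ₑ ^ 2 ∂P)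
            + 2 * ∫⁻ ω, ‖(S n).integral W t ω - I ω‖ₑ ^ 2 ∂P := by
          rw [lintegral_add_left ((hm.enorm.pow_const 2).const_mul 2),
            lintegral_const_mul' _ _ (by simp), lintegral_const_mul' _ _ (by simp)]
      _ ≤ _ := by
          rw [hiso]
          gcongr
          exact hIoc n
  refine tendsto_of_tendsto_of_tendsto_of_le_of_le tendsto_const_nhds ?_ (fun _ => zero_le) hbound
  have h1 := ENNReal.Tendsto.const_mul (a := 2) hc (Or.inr (by simp))
  have h2 := ENNReal.Tendsto.const_mul (a := 2) hS1 (Or.inr (by simp))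
  have h3 := ENNReal.Tendsto.const_mul (a := 2) hS2 (Or.inr (by simp))
  have h4 := ENNReal.Tendsto.const_mul (a := 2) (h1.add h2) (Or.inr (by simp))
  simpa using h4.add h3

/-! ### Identification of limits and of limit laws -/

section

variable {Ω : Type*} {mΩ : MeasurableSpace Ω} {P : Measure Ω}

/-- By Fatou's lemma, `∫ |Z - Y|²` is at most the limit of `∫ |X n - Y|²`, which is zero. -/
lemma ae_eq_of_tendsto_lintegral {X : ℕ → Ω → ℝ} {Y Z : Ω → ℝ} (hX : ∀ n, AEMeasurable (X n) P)
    (hY : AEMeasurable Y P) (hXY : Tendsto (fun n => ∫⁻ ω, ‖X n ω - Y ω‖ₑ ^ 2 ∂P) atTop (𝓝 0))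
    (hXZ : ∀ᵐ ω ∂P, Tendsto (fun n => X n ω) atTop (𝓝 (Z ω))) : Y =ᵐ[P] Z := by
  have hlim : ∀ᵐ ω ∂P, liminf (fun n => ‖X n ω - Y ω‖ₑ ^ 2) atTop = ‖Z ω - Y ω‖ₑ ^ 2 := by
    filter_upwards [hXZ] with ω hω
    exact Tendsto.liminf_eq
      (((ENNReal.continuous_pow 2).comp continuous_enorm).tendsto _ |>.comp (hω.sub_const (Y ω)))
  have h0 : ∫⁻ ω, ‖Z ω - Y ω‖ₑ ^ 2 ∂P = 0 := by
    have := lintegral_liminf_le' (u := atTop) (μ := P) (f := fun n ω => ‖X n ω - Y ω‖ₑ ^ 2)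
      fun n => ((hX n).sub hY).enorm.pow_const 2
    rw [hXY.liminf_eq, lintegral_congr_ae hlim] at this
    exact le_antisymm this zero_le
  rw [lintegral_eq_zero_iff' (f := fun ω => ‖Z ω - Y ω‖ₑ ^ 2)
    (((aemeasurable_of_tendsto_metrizable_ae atTop hX hXZ).sub hY).enorm.pow_const 2)] at h0
  filter_upwards [h0] with ω h1
  simp only [Pi.zero_apply, ne_eq, OfNat.ofNat_ne_zero, not_false_eq_true, pow_eq_zero_iff,
    enorm_eq_zero] at h1
  linarith

/-- Characteristic functions converge by dominated convergence, and the Gaussian ones depend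
continuously on the variance. -/
lemma map_eq_gaussianReal_of_tendsto [IsProbabilityMeasure P] {X : ℕ → Ω → ℝ} {Y : Ω → ℝ}
    {v : ℕ → NNReal} {v₀ : NNReal}
    (hX : ∀ n, HasLaw (X n) (gaussianReal 0 (v n)) P) (hY : AEMeasurable Y P)
    (hXY : ∀ᵐ ω ∂P, Tendsto (fun n => X n ω) atTop (𝓝 (Y ω))) (hv : Tendsto v atTop (𝓝 v₀)) :
    HasLaw Y (gaussianReal 0 v₀) P := by
  refine ⟨hY, ?_⟩
  have : IsProbabilityMeasure (P.map Y) := Measure.isProbabilityMeasure_map hY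
  refine Measure.ext_of_charFun (funext fun u => ?_)
  have hcf : ∀ {Z : Ω → ℝ}, AEMeasurable Z P →
      charFun (P.map Z) u = ∫ ω, Complex.exp (u * Z ω * Complex.I) ∂P := by
    intro Z hZ
    rw [charFun_apply_real, integral_map hZ (by fun_prop)]
  have h1 : Tendsto (fun n => charFun (P.map (X n)) u) atTop (𝓝 (charFun (P.map Y) u)) := by
    rw [hcf hY]
    simp_rw [fun n => hcf (hX n).aemeasurable]
    refine tendsto_integral_of_dominated_convergence (fun _ => 1) (fun n => ?_)
      (integrable_const _) (fun n => ae_of_all _ fun ω => ?_) ?_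
    · have := (hX n).aemeasurable
      exact AEMeasurable.aestronglyMeasurable (by fun_prop)
    · rw [← Complex.ofReal_mul, Complex.norm_exp_ofReal_mul_I]
    · filter_upwards [hXY] with ω hω
      have hc : Continuous fun x : ℝ => Complex.exp (u * x * Complex.I) := by fun_prop
      exact (hc.tendsto _).comp hω
  refine tendsto_nhds_unique h1 ?_
  simp_rw [fun n => (hX n).map_eq, charFun_gaussianReal]
  have hv' : Tendsto (fun n => ((v n : ℝ) : ℂ)) atTop (𝓝 ((v₀ : ℝ) : ℂ)) :=
    (Complex.continuous_ofReal.comp NNReal.continuous_coe).tendsto _ |>.comp hv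
  have hc : Continuous fun x : ℂ => Complex.exp (u * (0 : ℝ) * Complex.I - x * u ^ 2 / 2) := by
    fun_prop
  exact (hc.tendsto _).comp hv'

end

/-! ### Wiener integrals as continuous functionals of the path -/

section Wiener

variable {Ω : Type*} {mΩ : MeasurableSpace Ω} {T : ℝ} {P : Measure Ω}
  {𝓕 : Filtration (Icc (0 : ℝ) T) mΩ} {W : Icc (0 : ℝ) T → Ω → ℝ}

namespace IsBrownianMotion

lemma eval_zero (hW : IsBrownianMotion P 𝓕 W) (hT : 0 ≤ T) :
    ∀ᵐ ω ∂P, W ⟨0, left_mem_Icc.2 hT⟩ ω = 0 := hW.zero _ rfl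

lemma hasLaw_eval (hW : IsBrownianMotion P 𝓕 W) (hT : 0 ≤ T) (t : Icc (0 : ℝ) T) :
    HasLaw (W t) (gaussianReal 0 (Real.toNNReal t)) P := by
  have h := hW.increment_law ⟨0, left_mem_Icc.2 hT⟩ t t.2.1
  simp only [sub_zero] at h
  refine h.congr ?_
  filter_upwards [hW.eval_zero hT] with ω hω
  rw [hω, sub_zero]

lemma isGaussianProcess (hW : IsBrownianMotion P 𝓕 W) (hT : 0 ≤ T) [IsProbabilityMeasure P] :
    IsGaussianProcess W P := by
  let _ : OrderBot (Icc (0 : ℝ) T) :=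
    { bot := ⟨0, left_mem_Icc.2 hT⟩, bot_le := fun s => s.2.1 }
  exact HasIndepIncrements.isGaussianProcess (fun t => (hW.hasLaw_eval hT t).hasGaussianLaw)
    (hW.eval_zero hT) (HasIndepIncrements.of_nat fun t ht _ => hW.iIndepFun_increments ht)

lemma memLp_eval (hW : IsBrownianMotion P 𝓕 W) (hT : 0 ≤ T) (t : Icc (0 : ℝ) T) :
    MemLp (W t) 2 P :=
  (hW.hasLaw_eval hT t).hasGaussianLaw.memLp_two

lemma covariance_eval (hW : IsBrownianMotion P 𝓕 W) (hT : 0 ≤ T) [IsProbabilityMeasure P]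
    (s t : Icc (0 : ℝ) T) :
    cov[W s, W t; P] = min (s : ℝ) t := by
  wlog hst : s ≤ t generalizing s t
  · rw [covariance_comm, this t s (le_of_not_ge hst), min_comm]
  have h : W t = W s + fun ω => W t ω - W s ω := by ext ω; simp
  have hind := (hW.indepFun_sub hst (hW.adapted s)).symm
  rw [h, covariance_add_right (hW.memLp_eval hT s) (hW.memLp_eval hT s) (hW.memLp_sub hst),
    hind.covariance_eq_zero (hW.memLp_eval hT s) (hW.memLp_sub hst), add_zero,
    covariance_self (hW.measurable s).aemeasurable, (hW.hasLaw_eval hT s).variance_eq,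
    variance_id_gaussianReal, Real.coe_toNNReal _ s.2.1]
  exact (min_eq_left (Subtype.coe_le_coe.2 hst)).symm

/-- The elementary Wiener integral of a step function is Gaussian. -/
lemma hasLaw_sum_step (hW : IsBrownianMotion P 𝓕 W) (hT : 0 ≤ T) [IsProbabilityMeasure P]
    (f : ℝ → ℝ) (n : ℕ) :
    HasLaw (fun ω => ∑ i : Fin (n + 1), (W (node hT n (i + 1)) ω - W (node hT n i) ω) *
      f (node hT n i)) (gaussianReal 0 (∫⁻ s, ‖step hT f n s‖ₑ ^ 2 ∂(lebesgue T)).toNNReal) P := by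
  set X : Ω → ℝ := fun ω => ∑ i : Fin (n + 1), (W (node hT n (i + 1)) ω - W (node hT n i) ω) *
      f (node hT n i) with hX
  have hle : ∀ i : ℕ, node hT n i ≤ node hT n (i + 1) := fun i => node_mono hT n i.le_succ
  have hG : HasGaussianLaw X P := by
    have h1 := (hW.isGaussianProcess hT).hasGaussianLaw_increments
      (t := fun i : Fin (n + 1 + 1) => node hT n i)
    have h2 := h1.map (∑ i : Fin (n + 1), (f (node hT n i)) •
      ContinuousLinearMap.proj (R := ℝ) (φ := fun _ : Fin (n + 1) => ℝ) i)
    refine h2.congr (ae_of_all _ fun ω => ?_)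
    simp [hX, mul_comm]
  have hmean : P[X] = 0 := by
    simp only [hX]
    rw [integral_finsetSum (f := fun (i : Fin (n + 1)) ω =>
      (W (node hT n (i + 1)) ω - W (node hT n i) ω) * f (node hT n i)) _ fun i _ =>
      ((hW.memLp_sub (hle i)).integrable one_le_two).mul_const _]
    refine Finset.sum_eq_zero fun i _ => ?_
    rw [integral_mul_const, hW.integral_sub (hle i), zero_mul]
  have htop : ∀ s : Icc (0 : ℝ) T, s ≤ ⟨T, right_mem_Icc.2 hT⟩ := fun s => s.2.2
  have huniv : Iic (⟨T, right_mem_Icc.2 hT⟩ : Icc (0 : ℝ) T) = univ := eq_univ_of_forall htop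
  -- With deterministic coefficients, the isometry at the final time computes the variance.
  have hiso := hW.integral_elementary_sq (⟨T, right_mem_Icc.2 hT⟩ : Icc (0 : ℝ) T)
    (ι := Fin (n + 1)) (fun i => node hT n i) (fun i => node hT n (i + 1)) (fun i => hle i)
    (fun i _ => f (node hT n i)) (fun _ => stronglyMeasurable_const)
    (fun i => ⟨_, fun _ => le_rfl⟩)
  simp only [min_eq_right (htop _), huniv, Measure.restrict_univ, lintegral_const, measure_univ,
    mul_one] at hiso
  have hvar : Var[X; P].toNNReal = (∫⁻ s, ‖step hT f n s‖ₑ ^ 2 ∂(lebesgue T)).toNNReal := by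
    rw [variance_of_integral_eq_zero hG.aemeasurable hmean,
      integral_eq_lintegral_of_nonneg_ae (ae_of_all _ fun _ => sq_nonneg _)
        hG.memLp_two.integrable_sq.aestronglyMeasurable]
    have : ∀ ω, ENNReal.ofReal (X ω ^ 2) = ‖X ω‖ₑ ^ 2 := fun ω => by
      rw [← enorm_pow, Real.enorm_of_nonneg (sq_nonneg _)]
    simp_rw [this, hX, hiso]
    exact Real.toNNReal_coe
  refine ⟨hG.aemeasurable, ?_⟩
  rw [hG.isGaussian_map.eq_gaussianReal]
  have h1 : ∫ x, id x ∂(P.map X) = 0 := by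
    rw [integral_map hG.aemeasurable (by fun_prop)]; exact hmean
  rw [h1, variance_map (by fun_prop) hG.aemeasurable, ← hvar]
  rfl

end IsBrownianMotion

/-- The functional `w ↦ ∫_0^T g(s) w(s) ds`. -/
noncomputable def weightedIntegral (g : ℝ → ℝ) (w : C(Icc (0 : ℝ) T, ℝ)) : ℝ :=
  ∫ s, g s * w s ∂(lebesgue T)

lemma continuous_weightedIntegral {g : ℝ → ℝ} (hg : Continuous g) :
    Continuous (weightedIntegral (T := T) g) := by
  obtain ⟨C, hC⟩ : ∃ C, ∀ x ∈ Icc 0 T, ‖g x‖ ≤ C :=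
    isCompact_Icc.exists_bound_of_continuousOn hg.continuousOn
  have hint : ∀ w : C(Icc (0 : ℝ) T, ℝ), Integrable (fun s : Icc (0 : ℝ) T => g s * w s) (lebesgue T) := fun w =>
    (((hg.comp continuous_subtype_val).mul w.continuous)).integrable_of_hasCompactSupport
      (HasCompactSupport.of_compactSpace _)
  refine (LipschitzWith.of_dist_le_mul (K := Real.toNNReal (C * (lebesgue T).real univ))
    fun w w' => ?_).continuous
  rw [dist_eq_norm, weightedIntegral, weightedIntegral, ← integral_sub (hint w) (hint w')]
  refine (norm_integral_le_of_norm_le_const (C := C * dist w w') (ae_of_all _ fun s => ?_)).trans ?_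
  · rw [← mul_sub, norm_mul, ← dist_eq_norm (w s)]
    exact mul_le_mul (hC s s.2) (ContinuousMap.dist_apply_le_dist s) dist_nonneg
      ((norm_nonneg _).trans (hC s s.2))
  · rw [mul_right_comm]
    gcongr
    exact Real.le_coe_toNNReal _

/-- The variance `∫_0^T f(s)² ds` of the Wiener integral of `f`. -/
noncomputable def wienerVariance (T : ℝ) (f : ℝ → ℝ) : NNReal :=
  (∫⁻ s : Icc (0 : ℝ) T, ‖f s‖ₑ ^ 2 ∂(lebesgue T)).toNNReal

/-- The functional is the pathwise limit of Gaussian step sums; the boundary terms of the summation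
by parts vanish because `f T = 0` and `W_0 = 0`. The variances converge by dominated convergence. -/
lemma IsBrownianMotion.hasLaw_weightedIntegral (hW : IsBrownianMotion P 𝓕 W) (hT : 0 ≤ T)
    [IsProbabilityMeasure P] {f g : ℝ → ℝ} (hfg : ∀ x, HasDerivAt f (-g x) x)
    (hg : Continuous g) {C : ℝ} (hC : ∀ x, |f x| ≤ C) (hfT : f T = 0) :
    HasLaw (fun ω => weightedIntegral g (path W hW.continuous_paths ω))
      (gaussianReal 0 (wienerVariance T f)) P := by
  have hf : Continuous f := continuous_iff_continuousAt.2 fun x => (hfg x).continuousAt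
  have hlim : ∀ᵐ ω ∂P, Tendsto (fun n => ∑ i : Fin (n + 1),
      (W (node hT n (i + 1)) ω - W (node hT n i) ω) * f (node hT n i)) atTop
      (𝓝 (weightedIntegral g (path W hW.continuous_paths ω))) := by
    filter_upwards [hW.eval_zero hT] with ω hω
    have := tendsto_sum_mul_sub hT hfg hg (hW.continuous_paths ω)
    simpa [hfT, hω, weightedIntegral, path] using this
  refine map_eq_gaussianReal_of_tendsto (fun n => hW.hasLaw_sum_step hT f n)
    (aemeasurable_of_tendsto_metrizable_ae atTop
      (fun n => (hW.hasLaw_sum_step hT f n).aemeasurable) hlim) hlim ?_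
  have hfin : ∀ {φ : Icc (0 : ℝ) T → ℝ}, (∀ s : Icc (0 : ℝ) T, 0 < (s : ℝ) → |φ s| ≤ C) →
      ∀ᵐ s ∂(lebesgue T), ‖φ s‖ₑ ^ 2 ≤ ‖C‖ₑ ^ 2 := by
    intro φ hφ
    filter_upwards [ae_pos hT] with s hs
    gcongr
    rw [enorm_le_iff_norm_le, Real.norm_eq_abs, Real.norm_eq_abs]
    exact (hφ s hs).trans (le_abs_self _)
  have hconst : ∫⁻ _ : Icc (0 : ℝ) T, ‖C‖ₑ ^ 2 ∂(lebesgue T) ≠ ⊤ := by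
    rw [lintegral_const]; finiteness
  refine (ENNReal.tendsto_toNNReal ?_).comp ?_
  · exact ne_top_of_le_ne_top hconst (lintegral_mono_ae (hfin (φ := fun s => f s) fun s _ => hC s))
  · refine tendsto_lintegral_of_dominated_convergence (fun _ => ‖C‖ₑ ^ 2)
      (fun n => (measurable_step hT f n).enorm.pow_const 2)
      (fun n => hfin fun s hs => abs_step_le hT hC n hs) hconst ?_
    filter_upwards [ae_pos hT] with s hs
    exact ((ENNReal.continuous_pow 2).comp continuous_enorm).tendsto _ |>.comp
      (tendsto_step hT hf hs)

/-- The same step sums converge in `L²` to the Itô integral and pathwise to the weighted path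
integral. The pathwise limit is taken along `W` stopped at `t`; stopping does no harm because `f`
and `g` vanish from `t` on. -/
lemma IsItoIntegral.coord_eq_weightedIntegral [IsProbabilityMeasure P] (hT : 0 ≤ T)
    (hW : IsBrownianMotion P 𝓕 W) {d : ℕ} {H : Icc (0 : ℝ) T → Ω → EuclideanSpace ℝ (Fin d)}
    {t : Icc (0 : ℝ) T} {I : Ω → EuclideanSpace ℝ (Fin d)} (hI : IsItoIntegral P 𝓕 W H t I)
    (j : Fin d) {f g : ℝ → ℝ} (hfg : ∀ x, HasDerivAt f (-g x) x)
    (hg : Continuous g) {C : ℝ} (hC : ∀ x, |f x| ≤ C) (hft : ∀ s, (t : ℝ) ≤ s → f s = 0)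
    (hgt : ∀ s, (t : ℝ) ≤ s → g s = 0)
    (hH : ∀ᵐ ω ∂P, ∀ s ≤ t, H s ω j = f s) :
    ∀ᵐ ω ∂P, I ω j = weightedIntegral g (path W hW.continuous_paths ω) := by
  have hf : Continuous f := continuous_iff_continuousAt.2 fun x => (hfg x).continuousAt
  refine ae_eq_of_tendsto_lintegral (X := fun n ω => ∑ i : Fin (n + 1),
    (W (min t (node hT n (i + 1))) ω - W (min t (node hT n i)) ω) * f (node hT n i))
    (fun n => ?_) ?_ ?_ ?_
  · exact (Finset.measurable_sum _ fun i _ =>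
      ((hW.measurable _).sub (hW.measurable _)).mul_const _).aemeasurable
  · exact ((PiLp.continuous_apply 2 _ j).comp_aestronglyMeasurable
      hI.aestronglyMeasurable).aemeasurable
  · exact hI.tendsto_coord hW j (hf.measurable.comp measurable_subtype_coe) hH
      (m := fun n => n + 1) (l := fun n i => node hT n i) (r := fun n i => node hT n (i + 1))
      (c := fun n i => f (node hT n i))
      (fun n i => node_mono hT n (Nat.le_succ i)) (tendsto_lintegral_step hT hf hC t)
  · filter_upwards [hW.eval_zero hT] with ω hω
    have hc : Continuous fun s => W (min t s) ω :=
      (hW.continuous_paths ω).comp (continuous_const.min continuous_id)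
    have := tendsto_sum_mul_sub hT hfg hg hc
    have h0 : min t (⟨0, left_mem_Icc.2 hT⟩ : Icc (0 : ℝ) T) = ⟨0, left_mem_Icc.2 hT⟩ :=
      min_eq_right t.2.1
    rw [h0, hω, hft T t.2.2] at this
    have h1 : ∫ s, g s * W (min t s) ω ∂(lebesgue T)
        = weightedIntegral g (path W hW.continuous_paths ω) := by
      rw [weightedIntegral]
      congr 1
      ext s
      rcases le_total t s with h | h
      · rw [hgt s h, zero_mul, zero_mul]
      · rw [min_eq_right h]; rfl
    rw [h1] at this
    simpa using this

lemma IsItoIntegral.coord_eq_zero [IsProbabilityMeasure P]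
    (hW : IsBrownianMotion P 𝓕 W) {d : ℕ} {H : Icc (0 : ℝ) T → Ω → EuclideanSpace ℝ (Fin d)}
    {t : Icc (0 : ℝ) T} {I : Ω → EuclideanSpace ℝ (Fin d)} (hI : IsItoIntegral P 𝓕 W H t I)
    (j : Fin d) (hH : ∀ s ω, H s ω j = 0) :
    ∀ᵐ ω ∂P, I ω j = 0 := by
  refine ae_eq_of_tendsto_lintegral (X := fun _ _ => 0) (Z := fun _ => 0)
    (fun n => aemeasurable_const) ?_ ?_ ?_
  · exact ((PiLp.continuous_apply 2 _ j).comp_aestronglyMeasurable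
      hI.aestronglyMeasurable).aemeasurable
  -- The zero integrand is approximated by empty step sums.
  · have := hI.tendsto_coord hW j (φ := fun _ => 0) measurable_const
      (ae_of_all _ fun ω s _ => hH s ω) (m := fun _ => 0) (l := fun _ => Fin.elim0)
      (r := fun _ => Fin.elim0) (c := fun _ => Fin.elim0) (fun _ i => i.elim0) (by simp)
    simpa using this
  · exact ae_of_all _ fun _ => tendsto_const_nhds

end Wiener

/-! ### The deterministic clock and signal system -/

/-- The functions entering the coefficients of the equation: `h` depends on the signal coordinate,
`χ` and `κ` on the clock coordinate. The clock is perturbed by `h χ` during `[τ, L]` only, and `κ`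
reads the clock after `L`. -/
structure IsProfile (τ L : ℝ) (h χ κ : ℝ → ℝ) : Prop where
  continuous_h : Continuous h
  continuous_χ : Continuous χ
  continuous_κ : Continuous κ
  h_mem : ∀ x, h x ∈ Icc (0 : ℝ) (1 / 2)
  χ_mem : ∀ x, χ x ∈ Icc (0 : ℝ) 1
  χ_left : ∀ x ≤ τ, χ x = 0
  χ_right : ∀ x, L ≤ x → χ x = 0
  κ_left : ∀ x ≤ L, κ x = 0

namespace IsProfile

variable {T τ L : ℝ} {h χ κ x y : ℝ → ℝ}

lemma mul_le (hp : IsProfile τ L h χ κ) (a b : ℝ) : h a * χ b ≤ 1 / 2 := by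
  have h1 := hp.h_mem a
  have h2 := hp.χ_mem b
  calc h a * χ b ≤ 1 / 2 * 1 := mul_le_mul h1.2 h2.2 h2.1 (by norm_num)
    _ = _ := by norm_num

lemma one_le_speed (hp : IsProfile τ L h χ κ) (a b : ℝ) : 1 ≤ (1 - h a * χ b)⁻¹ := by
  have h1 := hp.mul_le a b
  have h2 := mul_nonneg (hp.h_mem a).1 (hp.χ_mem b).1
  exact (one_le_inv₀ (by linarith)).2 (by linarith)

lemma speed_le_two (hp : IsProfile τ L h χ κ) (a b : ℝ) : (1 - h a * χ b)⁻¹ ≤ 2 := by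
  have h1 := hp.mul_le a b
  rw [inv_le_comm₀ (by linarith) two_pos]
  linarith

lemma continuous_speed {A : Type*} [TopologicalSpace A] {x y : A → ℝ}
    (hp : IsProfile τ L h χ κ) (hx : Continuous x) (hy : Continuous y) :
    Continuous fun s => (1 - h (x s) * χ (y s))⁻¹ := by
  refine (continuous_const.sub
    ((hp.continuous_h.comp hx).mul (hp.continuous_χ.comp hy))).inv₀ fun s => ?_
  have := hp.mul_le (x s) (y s)
  exact fun h0 : 1 - h (x s) * χ (y s) = 0 => by linarith

/-- The speed is at least `1`, so the clock is increasing and never falls behind time. -/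
lemma le_clock (hp : IsProfile τ L h χ κ) (hx : Continuous x) (hy : Continuous y)
    (heq : ∀ t ∈ Icc 0 T, y t = ∫ s in (0 : ℝ)..t, (1 - h (x s) * χ (y s))⁻¹)
    {s t : ℝ} (hs : s ∈ Icc 0 T) (ht : t ∈ Icc 0 T) (hst : s ≤ t) : y s + (t - s) ≤ y t := by
  have hc := hp.continuous_speed hx hy
  rw [heq s hs, heq t ht, ← intervalIntegral.integral_add_adjacent_intervals
    (hc.intervalIntegrable 0 s) (hc.intervalIntegrable s t)]
  have h1 : ∫ _ in s..t, (1 : ℝ) ≤ ∫ r in s..t, (1 - h (x r) * χ (y r))⁻¹ :=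
    intervalIntegral.integral_mono_on hst (by simp) (hc.intervalIntegrable s t)
      fun r _ => hp.one_le_speed _ _
  simp only [intervalIntegral.integral_const, smul_eq_mul, mul_one] at h1
  linarith

lemma clock_zero (heq : ∀ t ∈ Icc 0 T, y t = ∫ s in (0 : ℝ)..t, (1 - h (x s) * χ (y s))⁻¹)
    (hT : 0 ≤ T) : y 0 = 0 := by
  rw [heq 0 (left_mem_Icc.2 hT), intervalIntegral.integral_same]

/-- The clock is exact up to time `τ`. -/
lemma clock_eq (hp : IsProfile τ L h χ κ) (hτT : τ ≤ T)
    (hx : Continuous x) (hy : Continuous y)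
    (heq : ∀ t ∈ Icc 0 T, y t = ∫ s in (0 : ℝ)..t, (1 - h (x s) * χ (y s))⁻¹)
    {t : ℝ} (ht : t ∈ Icc 0 τ) : y t = t := by
  have hT : 0 ≤ T := ht.1.trans (ht.2.trans hτT)
  -- By monotonicity the clock stays below `τ` on all of `[0, s]`, where `χ` vanishes and the speed
  -- is `1`.
  have key : ∀ s ∈ Icc 0 T, y s ≤ τ → y s = s := by
    intro s hs hys
    rw [heq s hs]
    have : ∫ r in (0 : ℝ)..s, (1 - h (x r) * χ (y r))⁻¹ = ∫ _ in (0 : ℝ)..s, (1 : ℝ) := by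
      refine intervalIntegral.integral_congr fun r hr => ?_
      rw [uIcc_of_le hs.1] at hr
      have := hp.le_clock hx hy heq ⟨hr.1, hr.2.trans hs.2⟩ hs hr.2
      rw [hp.χ_left (y r) (by linarith [hr.2]), mul_zero, sub_zero, inv_one]
    simp [this]
  have htT : t ∈ Icc 0 T := ⟨ht.1, ht.2.trans hτT⟩
  rcases le_or_gt (y t) τ with hyt | hyt
  · exact key t htT hyt
  · have h0 := clock_zero heq hT
    -- A clock beyond `τ` would have read `τ` at some `s ≤ t`; there `s = τ` by `key`, which forces
    -- `s = t`.
    obtain ⟨s, hs, hys⟩ := intermediate_value_Icc ht.1 hy.continuousOn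
      (show τ ∈ Icc (y 0) (y t) from ⟨by rw [h0]; exact ht.1.trans ht.2, hyt.le⟩)
    have h1 := key s ⟨hs.1, hs.2.trans htT.2⟩ hys.le
    have h2 : s = t := le_antisymm hs.2 (by rw [← h1, hys]; exact ht.2)
    rw [← h2, h1]

/-- The terminal value of the signal coordinate, as a function of its value at time `τ`. -/
lemma signal_terminal (hp : IsProfile τ L h χ κ) (hτ : 0 ≤ τ) (hτL : τ ≤ L) (hLT : L ≤ T)
    (hx : Continuous x) (hy : Continuous y)
    (heq : ∀ t ∈ Icc 0 T, y t = ∫ s in (0 : ℝ)..t, (1 - h (x s) * χ (y s))⁻¹)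
    {z : ℝ} (hxz : ∀ t ∈ Icc τ T, x t = z + ∫ s in (0 : ℝ)..t, κ (y s)) :
    x T = z + ∫ s in (0 : ℝ)..(T + h z * ∫ u in (0 : ℝ)..T, χ u), κ s := by
  have hτT := hτL.trans hLT
  have hT : 0 ≤ T := hτ.trans hτT
  have hTmem : T ∈ Icc 0 T := right_mem_Icc.2 hT
  have h0 := clock_zero heq hT
  have hle : ∀ t ∈ Icc 0 T, t ≤ y t := fun t ht => by
    have := hp.le_clock hx hy heq (left_mem_Icc.2 hT) ht ht.1
    linarith
  -- Where `χ` is nonzero the clock lies between `τ` and `L`. Then `s ≥ τ` because the clock is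
  -- exact earlier, and `κ` has not yet acted, so the signal still equals `z`.
  have hfrozen : ∀ s ∈ Icc 0 T, h (x s) * χ (y s) = h z * χ (y s) := by
    intro s hs
    rcases le_or_gt (y s) τ with h1 | h1
    · rw [hp.χ_left _ h1, mul_zero, mul_zero]
    rcases le_or_gt L (y s) with h2 | h2
    · rw [hp.χ_right _ h2, mul_zero, mul_zero]
    have hτs : τ ≤ s := by
      by_contra hlt
      have := hp.clock_eq hτT hx hy heq ⟨hs.1, (not_le.1 hlt).le⟩
      linarith
    have : ∫ r in (0 : ℝ)..s, κ (y r) = ∫ _ in (0 : ℝ)..s, (0 : ℝ) := by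
      refine intervalIntegral.integral_congr fun r hr => ?_
      rw [uIcc_of_le hs.1] at hr
      have := hp.le_clock hx hy heq ⟨hr.1, hr.2.trans hs.2⟩ hs hr.2
      exact hp.κ_left _ (by linarith [hr.2])
    rw [hxz s ⟨hτs, hs.2⟩, this, intervalIntegral.integral_zero, add_zero]
  have hc := hp.continuous_speed hx hy
  set m : ℝ → ℝ := fun s => (1 - h (x s) * χ (y s))⁻¹ with hm
  set Y : ℝ → ℝ := fun t => ∫ s in (0 : ℝ)..t, m s with hY
  have hYd : ∀ t, HasDerivAt Y (m t) t := fun t => hc.integral_hasStrictDerivAt 0 t |>.hasDerivAt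
  have hYy : ∀ t ∈ Icc 0 T, Y t = y t := fun t ht => (heq t ht).symm
  have hY0 : Y 0 = 0 := by rw [hYy 0 (left_mem_Icc.2 hT), h0]
  set Ξ : ℝ → ℝ := fun t => ∫ u in (0 : ℝ)..t, χ u with hΞ
  have hΞd : ∀ t, HasDerivAt Ξ (χ t) t := fun t =>
    hp.continuous_χ.integral_hasStrictDerivAt 0 t |>.hasDerivAt
  set Q : ℝ → ℝ := fun t => ∫ u in (0 : ℝ)..t, κ u with hQ
  have hQd : ∀ t, HasDerivAt Q (κ t) t := fun t =>
    hp.continuous_κ.integral_hasStrictDerivAt 0 t |>.hasDerivAt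
  -- Separation of variables: the clock satisfies `(1 - h z * χ Y) Y' = 1`, so `Y - h z * Ξ Y - t`
  -- is constant.
  have hYT : Y T - h z * Ξ (Y T) - T = 0 := by
    have hd : ∀ t, HasDerivAt (fun t => Y t - h z * Ξ (Y t) - t)
        (m t - h z * (χ (Y t) * m t) - 1) t := fun t =>
      ((hYd t).sub (((hΞd (Y t)).comp t (hYd t)).const_mul (h z))).sub (hasDerivAt_id t)
    have := constant_of_has_deriv_right_zero (a := 0) (b := T)
      (f := fun t => Y t - h z * Ξ (Y t) - t)
      (fun t _ => (hd t).continuousAt.continuousWithinAt) (fun t ht => by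
        convert! (hd t).hasDerivWithinAt using 1
        have ht' : t ∈ Icc 0 T := Ico_subset_Icc_self ht
        have h1 := hp.mul_le (x t) (y t)
        have h2 : m t = (1 - h z * χ (y t))⁻¹ := by rw [hm, ← hfrozen t ht']
        rw [hfrozen t ht'] at h1
        rw [hYy t ht', h2]
        field_simp [show 1 - h z * χ (y t) ≠ 0 from fun h => by linarith]
        ring) T hTmem
    rw [this]
    simp [hY0, hΞ]
  have hΞT : Ξ (Y T) = Ξ T := by
    have h1 : T ≤ Y T := by rw [hYy T hTmem]; exact hle T hTmem
    have h2 : ∫ u in T..(Y T), χ u = ∫ _ in T..(Y T), (0 : ℝ) := by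
      refine intervalIntegral.integral_congr fun u hu => ?_
      rw [uIcc_of_le h1] at hu
      exact hp.χ_right u (hLT.trans hu.1)
    have h3 := intervalIntegral.integral_add_adjacent_intervals
      (hp.continuous_χ.intervalIntegrable (μ := volume) 0 T)
      (hp.continuous_χ.intervalIntegrable T (Y T))
    rw [h2, intervalIntegral.integral_zero, add_zero] at h3
    exact h3.symm
  -- Substitution without a Jacobian: wherever `κ` is nonzero the clock is past `L` and has speed
  -- `1`.
  have hint : ∫ s in (0 : ℝ)..T, κ (y s) = Q (Y T) := by
    have h1 : ∫ s in (0 : ℝ)..T, κ (y s) = Q (Y T) - Q (Y 0) := by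
      refine intervalIntegral.integral_eq_sub_of_hasDerivAt (f := fun t => Q (Y t))
        (fun t ht => ?_) ((hp.continuous_κ.comp hy).intervalIntegrable _ _)
      rw [uIcc_of_le hT] at ht
      convert! (hQd (Y t)).comp t (hYd t) using 1
      rw [hYy t ht]
      rcases le_or_gt (y t) L with h2 | h2
      · rw [hp.κ_left _ h2, zero_mul]
      · rw [hm]
        simp [hp.χ_right _ h2.le]
    rw [h1, hY0]
    simp [hQ]
  rw [hxz T ⟨hτT, le_rfl⟩, hint, show Y T = T + h z * Ξ T by rw [← hΞT]; linarith]

end IsProfile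

/-! ### Pathwise reduction of the stochastic equation -/

/-- Equality on a countable dense set propagates by continuity. This turns an equation with an
exceptional null set for each time into one valid at all times off a single null set. -/
lemma ae_forall_eq_of_forall_ae_eq {Ω A : Type*} {mΩ : MeasurableSpace Ω} {P : Measure Ω}
    [TopologicalSpace A] [TopologicalSpace.SeparableSpace A] {u v : A → Ω → ℝ}
    (hu : ∀ ω, Continuous fun a => u a ω) (hv : ∀ ω, Continuous fun a => v a ω)
    (huv : ∀ a, ∀ᵐ ω ∂P, u a ω = v a ω) : ∀ᵐ ω ∂P, ∀ a, u a ω = v a ω := by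
  obtain ⟨s, hs, hd⟩ := TopologicalSpace.exists_countable_dense A
  have := (ae_ball_iff hs).2 fun a (_ : a ∈ s) => huv a
  filter_upwards [this] with ω hω a
  exact congrFun (Continuous.ext_on hd (hu ω) (hv ω) fun a ha => hω a ha) a

section Coefficients

variable {d : ℕ}

/-- The drift: the clock reading `κ` moves the signal coordinate `i`, the clock coordinate `j`
runs at speed `1 / (1 - h χ)`. -/
noncomputable def drift (i j : Fin d) (c : ℝ) (h χ κ : ℝ → ℝ) (x : EuclideanSpace ℝ (Fin d)) :
    EuclideanSpace ℝ (Fin d) :=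
  EuclideanSpace.single i (κ (x j - c)) + EuclideanSpace.single j (1 - h (x i) * χ (x j - c))⁻¹

/-- The diffusion coefficient: noise of intensity `f` at clock time acts on the coordinate `i`. -/
noncomputable def diffusion (i j : Fin d) (c : ℝ) (f : ℝ → ℝ) (x : EuclideanSpace ℝ (Fin d)) :
    EuclideanSpace ℝ (Fin d) :=
  EuclideanSpace.single i (f (x j - c))

variable {Ω : Type*} {mΩ : MeasurableSpace Ω} {T : ℝ} {P : Measure Ω}
  {𝓕 : Filtration (Icc (0 : ℝ) T) mΩ} {W : Icc (0 : ℝ) T → Ω → ℝ}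
  {X : Icc (0 : ℝ) T → Ω → EuclideanSpace ℝ (Fin d)}

lemma integral_coord {φ : Icc (0 : ℝ) T → EuclideanSpace ℝ (Fin d)} (hφ : Continuous φ)
    (s : Set (Icc (0 : ℝ) T)) (i : Fin d) :
    (∫ r in s, φ r ∂(lebesgue T)) i = ∫ r in s, φ r i ∂(lebesgue T) := by
  have hint : IntegrableOn φ s (lebesgue T) :=
    (hφ.integrable_of_hasCompactSupport (HasCompactSupport.of_compactSpace _)).integrableOn
  exact ((EuclideanSpace.proj (𝕜 := ℝ) (ι := Fin d) i).integral_comp_comm hint).symm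

lemma continuous_integral_Iic (hT : 0 ≤ T) {φ : Icc (0 : ℝ) T → ℝ} (hφ : Continuous φ) :
    Continuous fun t : Icc (0 : ℝ) T => ∫ s in Iic t, φ s ∂(lebesgue T) := by
  simp_rw [integral_lebesgue_eq hT]
  have hc : Continuous (IccExtend hT φ) := hφ.Icc_extend'
  exact (continuous_iff_continuousAt.2 fun t =>
    (hc.integral_hasStrictDerivAt 0 t).hasDerivAt.continuousAt).comp continuous_subtype_val

/-- The clock coordinate carries no noise, so almost every path satisfies the deterministic clock
equation. This makes the diffusion of the signal a deterministic function of time, hence its Itô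
integral a path functional, and `IsProfile.signal_terminal` applies path by path. -/
theorem IsSDESolution.coord_terminal [IsProbabilityMeasure P] {τ L : ℝ} (hτ : 0 ≤ τ) (hτL : τ ≤ L)
    (hLT : L ≤ T) {f g h χ κ : ℝ → ℝ} (hp : IsProfile τ L h χ κ)
    (hfg : ∀ x, HasDerivAt f (-g x) x) (hg : Continuous g) {C : ℝ} (hC : ∀ x, |f x| ≤ C)
    (hfτ : ∀ s, τ ≤ s → f s = 0) (hgτ : ∀ s, τ ≤ s → g s = 0)
    {i j : Fin d} (hij : i ≠ j) {ξ : EuclideanSpace ℝ (Fin d)} (hW : IsBrownianMotion P 𝓕 W)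
    (hX : IsSDESolution P 𝓕 W ξ (drift i j (ξ j) h χ κ) (diffusion i j (ξ j) f) X) :
    ∀ᵐ ω ∂P, X ⟨T, right_mem_Icc.2 (hτ.trans (hτL.trans hLT))⟩ ω i
      = (ξ i + weightedIntegral g (path W hW.continuous_paths ω))
        + ∫ s in (0 : ℝ)..(T + h (ξ i + weightedIntegral g (path W hW.continuous_paths ω)) *
            ∫ u in (0 : ℝ)..T, χ u), κ s := by
  have hτT := hτL.trans hLT
  have hT : 0 ≤ T := hτ.trans hτT
  have hXc : ∀ k ω, Continuous fun t => X t ω k := fun k ω =>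
    (PiLp.continuous_apply 2 _ k).comp (hX.continuous_paths ω)
  have hyc : ∀ ω, Continuous fun t => X t ω j - ξ j := fun ω => (hXc j ω).sub continuous_const
  have hsc : ∀ ω, Continuous fun t => (1 - h (X t ω i) * χ (X t ω j - ξ j))⁻¹ := fun ω =>
    hp.continuous_speed (hXc i ω) (hyc ω)
  have hκc : ∀ ω, Continuous fun t => κ (X t ω j - ξ j) := fun ω => hp.continuous_κ.comp (hyc ω)
  have hdc : ∀ ω, Continuous fun t => drift i j (ξ j) h χ κ (X t ω) := by
    intro ω
    have hs : ∀ k : Fin d, Continuous fun a : ℝ => EuclideanSpace.single k a := fun k => by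
      refine (PiLp.continuous_toLp 2 _).comp (continuous_pi fun l => ?_)
      by_cases hl : l = k
      · subst hl; simpa using continuous_id'
      · simpa [Pi.single_apply, hl] using continuous_const
    exact ((hs i).comp (hκc ω)).add ((hs j).comp (hsc ω))
  have hdi : ∀ x, drift i j (ξ j) h χ κ x i = κ (x j - ξ j) := fun x => by
    simp [drift, hij]
  have hdj : ∀ x, drift i j (ξ j) h χ κ x j = (1 - h (x i) * χ (x j - ξ j))⁻¹ := fun x => by
    simp [drift, hij.symm]
  have hclock : ∀ᵐ ω ∂P, ∀ t, X t ω j - ξ j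
      = ∫ s in Iic t, (1 - h (X s ω i) * χ (X s ω j - ξ j))⁻¹ ∂(lebesgue T) := by
    refine ae_forall_eq_of_forall_ae_eq hyc (fun ω => continuous_integral_Iic hT (hsc ω)) fun t => ?_
    obtain ⟨I, hI, hIX⟩ := hX.equation t
    have h0 := hI.coord_eq_zero hW j fun s ω => by simp [diffusion, hij.symm]
    filter_upwards [hIX, h0] with ω h1 h2
    rw [h1, PiLp.add_apply, PiLp.add_apply, h2, integral_coord (hdc ω)]
    simp only [hdj]
    ring
  have hclock' : ∀ᵐ ω ∂P, ∀ t ∈ Icc (0 : ℝ) T, IccExtend hT (fun t => X t ω j - ξ j) t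
      = ∫ s in (0 : ℝ)..t, (1 - h (IccExtend hT (fun t => X t ω i) s) *
          χ (IccExtend hT (fun t => X t ω j - ξ j) s))⁻¹ := by
    filter_upwards [hclock] with ω hω t ht
    have := hω ⟨t, ht⟩
    rw [integral_lebesgue_eq hT] at this
    rw [IccExtend_of_mem hT _ ht, this]
    rfl
  -- Up to `τ` the clock is exact; afterwards clock and time are both at least `τ`, where `f`
  -- vanishes.
  have hnoise : ∀ᵐ ω ∂P, ∀ s : Icc (0 : ℝ) T, f (X s ω j - ξ j) = f s := by
    filter_upwards [hclock'] with ω hω s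
    have hci : Continuous (IccExtend hT fun t => X t ω i) := (hXc i ω).Icc_extend'
    have hcj : Continuous (IccExtend hT fun t => X t ω j - ξ j) := (hyc ω).Icc_extend'
    have hval := IccExtend_val hT (fun t => X t ω j - ξ j) s
    rcases le_total (s : ℝ) τ with hs | hs
    · have := hp.clock_eq hτT hci hcj hω ⟨s.2.1, hs⟩
      rw [hval] at this
      rw [this]
    · have := hp.le_clock hci hcj hω (left_mem_Icc.2 hT) s.2 s.2.1
      rw [hval, IsProfile.clock_zero hω hT] at this
      rw [hfτ s hs, hfτ _ (by linarith)]
  have hsignal : ∀ᵐ ω ∂P, ∀ t : {t : Icc (0 : ℝ) T // τ ≤ t}, X t ω i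
      = (ξ i + weightedIntegral g (path W hW.continuous_paths ω))
        + ∫ s in Iic (t : Icc (0 : ℝ) T), κ (X s ω j - ξ j) ∂(lebesgue T) := by
    refine ae_forall_eq_of_forall_ae_eq (fun ω => (hXc i ω).comp continuous_subtype_val)
      (fun ω => continuous_const.add
        ((continuous_integral_Iic hT (hκc ω)).comp continuous_subtype_val)) fun t => ?_
    obtain ⟨I, hI, hIX⟩ := hX.equation t
    have h0 := hI.coord_eq_weightedIntegral hT hW i hfg hg hC
      (fun s hs => hfτ s (t.2.trans hs)) (fun s hs => hgτ s (t.2.trans hs)) (by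
        filter_upwards [hnoise] with ω hω s _
        simp [diffusion, hω s])
    filter_upwards [hIX, h0] with ω h1 h2
    rw [h1, PiLp.add_apply, PiLp.add_apply, h2, integral_coord (hdc ω)]
    simp only [hdi]
    ring
  filter_upwards [hclock', hsignal] with ω hω1 hω2
  have hci : Continuous (IccExtend hT fun t => X t ω i) := (hXc i ω).Icc_extend'
  have hcj : Continuous (IccExtend hT fun t => X t ω j - ξ j) := (hyc ω).Icc_extend'
  have := hp.signal_terminal (z := ξ i + weightedIntegral g (path W hW.continuous_paths ω))
    hτ hτL hLT hci hcj hω1 fun t ht => by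
      have htm : t ∈ Icc 0 T := ⟨hτ.trans ht.1, ht.2⟩
      have h3 := hω2 ⟨⟨t, htm⟩, ht.1⟩
      rw [integral_lebesgue_eq hT] at h3
      rw [IccExtend_of_mem hT _ htm, h3]
      rfl
  rw [IccExtend_of_mem hT _ (right_mem_Icc.2 hT)] at this
  exact this

end Coefficients

/-! ### Lower bounds by test functions -/

/-- A lower bound for the distance in mean of `F (α U + B)` from the functions of `U`, where `B` is
independent of `U`: it suffices that a bounded test function `s` of `α U + B` is nearly orthogonal
to the functions of `U`. -/
lemma le_lintegral_sub_of_indepFun {Ω A : Type*} {mΩ : MeasurableSpace Ω} {mA : MeasurableSpace A}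
    {P : Measure Ω} [IsProbabilityMeasure P] {U : Ω → A} {B : Ω → ℝ} (hU : Measurable U)
    (hB : Measurable B) (hUB : IndepFun U B P) {α u : A → ℝ} (hα : Measurable α)
    (hu : Measurable u) {F s : ℝ → ℝ} (hs : Measurable s) (hs1 : ∀ x, |s x| ≤ 1)
    (hF : Integrable (fun ω => F (α (U ω) + B ω)) P) {q : ℝ}
    (hq : ∀ a, |∫ b, s (a + b) ∂(P.map B)| ≤ q) :
    ENNReal.ofReal (1 / 2 * (∫ ω, F (α (U ω) + B ω) * s (α (U ω) + B ω) ∂P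
      - q * ∫ ω, |F (α (U ω) + B ω)| ∂P)) ≤ ∫⁻ ω, ‖F (α (U ω) + B ω) - u (U ω)‖ₑ ∂P := by
  -- Once the distance is finite, `u (U)` is integrable, which the orthogonality below requires.
  by_cases htop : ∫⁻ ω, ‖F (α (U ω) + B ω) - u (U ω)‖ₑ ∂P = ⊤
  · rw [htop]; exact le_top
  have : IsProbabilityMeasure (P.map B) := Measure.isProbabilityMeasure_map hB.aemeasurable
  have : IsProbabilityMeasure (P.map U) := Measure.isProbabilityMeasure_map hU.aemeasurable
  have huU : AEStronglyMeasurable (fun ω => u (U ω)) P := (hu.comp hU).aestronglyMeasurable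
  have hFu : Integrable (fun ω => F (α (U ω) + B ω) - u (U ω)) P :=
    ⟨hF.aestronglyMeasurable.sub huU, lt_top_iff_ne_top.2 htop⟩
  have huint : Integrable (fun ω => u (U ω)) P := by
    refine (hF.sub hFu).congr (ae_of_all _ fun ω => ?_)
    simp
  set r : A → ℝ := fun a => ∫ b, s (α a + b) ∂(P.map B) with hr
  have hsm : Measurable fun z : A × ℝ => s (α z.1 + z.2) :=
    hs.comp ((hα.comp measurable_fst).add measurable_snd)
  have hrm : Measurable r :=
    (StronglyMeasurable.integral_prod_right (f := fun a b => s (α a + b))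
      hsm.stronglyMeasurable).measurable
  have hr1 : ∀ a, |r a| ≤ 1 := fun a => by
    rw [← Real.norm_eq_abs]
    refine (norm_integral_le_of_norm_le_const (C := 1) (ae_of_all _ fun b => hs1 _)).trans ?_
    simp
  -- By independence, `r (U)` is the conditional mean of the test function given `U`. So `φ` is
  -- orthogonal to `u (U)`; its bound `2` produces the factor `1 / 2` in the conclusion, and `|r| ≤
  -- q` the error term.
  set φ : Ω → ℝ := fun ω => s (α (U ω) + B ω) - r (U ω) with hφ
  have hsΩ : Measurable fun ω => s (α (U ω) + B ω) := hs.comp ((hα.comp hU).add hB)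
  have hφm : Measurable φ := hsΩ.sub (hrm.comp hU)
  have hφ2 : ∀ ω, |φ ω| ≤ 2 := fun ω => by
    refine (abs_sub _ _).trans ?_
    linarith [hs1 (α (U ω) + B ω), hr1 (U ω)]
  have hbdd : ∀ {f : Ω → ℝ} {ψ : Ω → ℝ} {C : ℝ}, Integrable f P → Measurable ψ →
      (∀ ω, |ψ ω| ≤ C) → Integrable (fun ω => f ω * ψ ω) P := fun hf hψ hC =>
    hf.mul_bdd hψ.aestronglyMeasurable (ae_of_all _ hC)
  have hortho : ∫ ω, u (U ω) * φ ω ∂P = 0 := by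
    have hmap := hUB.map_prod_eq_prod_map_map hU.aemeasurable hB.aemeasurable
    have hgm : Measurable fun z : A × ℝ => u z.1 * (s (α z.1 + z.2) - r z.1) :=
      (hu.comp measurable_fst).mul (hsm.sub (hrm.comp measurable_fst))
    have h1 : ∫ ω, u (U ω) * φ ω ∂P
        = ∫ z, u z.1 * (s (α z.1 + z.2) - r z.1) ∂((P.map U).prod (P.map B)) := by
      rw [← hmap, integral_map (hU.prodMk hB).aemeasurable hgm.aestronglyMeasurable]
    have hint : Integrable (fun z : A × ℝ => u z.1 * (s (α z.1 + z.2) - r z.1))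
        ((P.map U).prod (P.map B)) := by
      rw [← hmap, integrable_map_measure hgm.aestronglyMeasurable (hU.prodMk hB).aemeasurable]
      exact hbdd huint hφm hφ2
    rw [h1, integral_prod _ hint]
    refine integral_eq_zero_of_ae (ae_of_all _ fun a => ?_)
    have hi : Integrable (fun b => s (α a + b)) (P.map B) :=
      Integrable.of_bound (hs.comp (measurable_const.add measurable_id)).aestronglyMeasurable 1
        (ae_of_all _ fun b => hs1 _)
    simp only [integral_const_mul, Pi.zero_apply]
    rw [integral_sub hi (integrable_const _)]
    simp [hr]
  have hFφ : ∫ ω, F (α (U ω) + B ω) * φ ω ∂P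
      = ∫ ω, F (α (U ω) + B ω) * s (α (U ω) + B ω) ∂P
        - ∫ ω, F (α (U ω) + B ω) * r (U ω) ∂P := by
    rw [← integral_sub (hbdd hF hsΩ fun ω => hs1 _)
      (hbdd (ψ := fun ω => r (U ω)) hF (hrm.comp hU) fun ω => hr1 _)]
    congr 1; ext ω; simp only [hφ]; ring
  have hFr : ∫ ω, F (α (U ω) + B ω) * r (U ω) ∂P ≤ q * ∫ ω, |F (α (U ω) + B ω)| ∂P := by
    rw [← integral_const_mul]
    refine integral_mono (hbdd (ψ := fun ω => r (U ω)) hF (hrm.comp hU) fun ω => hr1 _)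
      (hF.abs.const_mul q) fun ω => ?_
    refine (le_abs_self _).trans ?_
    rw [abs_mul, mul_comm]
    exact mul_le_mul_of_nonneg_right (hq _) (abs_nonneg _)
  have hmain : ∫ ω, (F (α (U ω) + B ω) - u (U ω)) * φ ω ∂P
      ≤ 2 * ∫ ω, |F (α (U ω) + B ω) - u (U ω)| ∂P := by
    rw [← integral_const_mul]
    refine integral_mono (hbdd hFu hφm hφ2) (hFu.abs.const_mul 2) fun ω => ?_
    refine (le_abs_self _).trans ?_
    rw [abs_mul, mul_comm]
    exact mul_le_mul_of_nonneg_right (hφ2 _) (abs_nonneg _)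
  have hsplit : ∫ ω, (F (α (U ω) + B ω) - u (U ω)) * φ ω ∂P
      = ∫ ω, F (α (U ω) + B ω) * φ ω ∂P := by
    rw [← sub_zero (∫ ω, F (α (U ω) + B ω) * φ ω ∂P), ← hortho,
      ← integral_sub (hbdd hF hφm hφ2) (hbdd huint hφm hφ2)]
    congr 1; ext ω; ring
  have hnorm : ∫⁻ ω, ‖F (α (U ω) + B ω) - u (U ω)‖ₑ ∂P
      = ENNReal.ofReal (∫ ω, |F (α (U ω) + B ω) - u (U ω)| ∂P) :=
    (ofReal_integral_norm_eq_lintegral_enorm hFu).symm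
  rw [hnorm]
  exact ENNReal.ofReal_le_ofReal (by linarith)

/-! ### Gaussian means of rapid oscillations -/

lemma hasDerivAt_gaussianPDFReal (c : ℝ) {v : NNReal} (hv : v ≠ 0) (x : ℝ) :
    HasDerivAt (gaussianPDFReal c v) (-((x - c) / v) * gaussianPDFReal c v x) x := by
  have h1 : HasDerivAt (fun x => -(x - c) ^ 2 / (2 * (v : ℝ))) (-((x - c) / v)) x := by
    have := ((((hasDerivAt_id x).sub_const c).pow 2).neg).div_const (2 * (v : ℝ))
    convert! this using 1
    have : (v : ℝ) ≠ 0 := by exact_mod_cast hv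
    simp
    field_simp
  rw [gaussianPDFReal_def]
  convert! (h1.exp).const_mul ((√(2 * Real.pi * v))⁻¹) using 1
  ring

lemma gaussianPDFReal_le (c : ℝ) {v : NNReal} (hv : v ≠ 0) (x : ℝ) :
    gaussianPDFReal c v x ≤ (√v)⁻¹ := by
  have hv0 : (0 : ℝ) < v := by positivity
  rw [gaussianPDFReal]
  have h1 : Real.exp (-(x - c) ^ 2 / (2 * v)) ≤ 1 := by
    rw [Real.exp_le_one_iff]
    exact div_nonpos_of_nonpos_of_nonneg (neg_nonpos.2 (sq_nonneg _)) (by positivity)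
  have h2 : (√(2 * Real.pi * v))⁻¹ ≤ (√v)⁻¹ := by
    refine inv_anti₀ (Real.sqrt_pos.2 hv0) (Real.sqrt_le_sqrt ?_)
    nlinarith [Real.pi_gt_three]
  calc _ ≤ (√v)⁻¹ * 1 := mul_le_mul h2 h1 (Real.exp_pos _).le (by positivity)
    _ = _ := mul_one _

lemma abs_deriv_gaussianPDFReal_le (c : ℝ) {v : NNReal} (hv : v ≠ 0) (x : ℝ) :
    |-((x - c) / v) * gaussianPDFReal c v x| ≤ (v : ℝ)⁻¹ := by
  have hv0 : (0 : ℝ) < v := by positivity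
  set w := √(v : ℝ) with hw
  have hw0 : 0 < w := Real.sqrt_pos.2 hv0
  have hwv : w ^ 2 = v := Real.sq_sqrt hv0.le
  set y := |x - c| with hy
  -- It suffices to bound the exponential below by its tangent line, `exp r ≥ 1 + r`, and complete a
  -- square.
  have hexp : y * Real.exp (-(x - c) ^ 2 / (2 * v)) ≤ w := by
    have h1 : 1 + (x - c) ^ 2 / (2 * v) ≤ Real.exp ((x - c) ^ 2 / (2 * v)) := by
      rw [add_comm]; exact Real.add_one_le_exp _
    have h2 : y ≤ w * (1 + (x - c) ^ 2 / (2 * v)) := by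
      rw [← sq_abs (x - c), ← hy, ← hwv]
      have : w * (1 + y ^ 2 / (2 * w ^ 2)) - y = ((y - w) ^ 2 + w ^ 2) / (2 * w) := by
        field_simp; ring
      have : 0 ≤ ((y - w) ^ 2 + w ^ 2) / (2 * w) := by positivity
      linarith
    rw [neg_div, Real.exp_neg, ← div_eq_mul_inv, div_le_iff₀ (Real.exp_pos _)]
    exact h2.trans (mul_le_mul_of_nonneg_left h1 hw0.le)
  have h2 : (√(2 * Real.pi * v))⁻¹ ≤ w⁻¹ := by
    refine inv_anti₀ hw0 (Real.sqrt_le_sqrt ?_)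
    nlinarith [Real.pi_gt_three]
  rw [abs_mul, abs_neg, abs_div, abs_of_pos hv0, abs_of_nonneg (gaussianPDFReal_nonneg _ _ _),
    gaussianPDFReal, ← hy]
  calc y / v * ((√(2 * Real.pi * v))⁻¹ * Real.exp (-(x - c) ^ 2 / (2 * v)))
      = (v : ℝ)⁻¹ * ((√(2 * Real.pi * v))⁻¹ * (y * Real.exp (-(x - c) ^ 2 / (2 * v)))) := by ring
    _ ≤ (v : ℝ)⁻¹ * (w⁻¹ * w) := by
        refine mul_le_mul_of_nonneg_left ?_ (by positivity)
        exact mul_le_mul h2 hexp (by positivity) (by positivity)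
    _ = _ := by rw [inv_mul_cancel₀ hw0.ne', mul_one]

/-- The mean of a rapid oscillation under Gaussian laws is small, uniformly in the mean. -/
lemma abs_integral_cos_gaussianReal_le {l r : ℝ} (hlr : l ≤ r) {N : ℝ} (hN : 0 < N) {v : NNReal}
    {e : ℝ} (he : 0 < e) (hev : e ≤ v) (a : ℝ) :
    |∫ b, (Icc l r).indicator (fun x => Real.cos (N * x)) (a + b) ∂(gaussianReal 0 v)|
      ≤ (2 * (√e)⁻¹ + e⁻¹ * (r - l)) / N := by
  have hv0 : (0 : ℝ) < v := he.trans_le hev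
  have hv : v ≠ 0 := by rintro rfl; simp at hv0
  set p := gaussianPDFReal a v with hp
  set p' : ℝ → ℝ := fun x => -((x - a) / v) * p x with hp'
  have hpd : ∀ x, HasDerivAt p (p' x) x := fun x => hasDerivAt_gaussianPDFReal a hv x
  have hpc : Continuous p := continuous_iff_continuousAt.2 fun x => (hpd x).continuousAt
  have hp'c : Continuous p' := by fun_prop
  have h1 : ∫ b, (Icc l r).indicator (fun x => Real.cos (N * x)) (a + b) ∂(gaussianReal 0 v)
      = ∫ x in l..r, p x * Real.cos (N * x) := by
    have hm : Measurable ((Icc l r).indicator fun x => Real.cos (N * x)) :=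
      Measurable.indicator (by fun_prop) measurableSet_Icc
    have h2 := integral_map (μ := gaussianReal 0 v) (φ := fun b => a + b) (by fun_prop)
      (f := (Icc l r).indicator fun x => Real.cos (N * x)) hm.aestronglyMeasurable
    rw [← h2, gaussianReal_map_const_add, zero_add, integral_gaussianReal_eq_integral_smul hv,
      intervalIntegral.integral_of_le hlr, ← integral_Icc_eq_integral_Ioc,
      ← integral_indicator measurableSet_Icc]
    congr 1; ext x
    by_cases hx : x ∈ Icc l r
    · rw [indicator_of_mem hx, indicator_of_mem hx, smul_eq_mul]
    · rw [indicator_of_notMem hx, indicator_of_notMem hx, smul_zero]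
  have hsin : ∀ x, HasDerivAt (fun x => Real.sin (N * x) / N) (Real.cos (N * x)) x := by
    intro x
    have := ((hasDerivAt_id x).const_mul N).sin.div_const N
    convert! this using 1
    simp
    field_simp
  -- Integration by parts gains `1 / N`. The density and its derivative are bounded in terms of `e`
  -- alone, uniformly in the mean `a` and in all variances at least `e`.
  rw [h1, intervalIntegral.integral_mul_deriv_eq_deriv_mul (fun x _ => hpd x) (fun x _ => hsin x)
    (hp'c.intervalIntegrable _ _) (Continuous.intervalIntegrable (by fun_prop) _ _)]
  have hs : ∀ x, |Real.sin (N * x) / N| ≤ 1 / N := fun x => by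
    rw [abs_div, abs_of_pos hN]
    exact div_le_div_of_nonneg_right (Real.abs_sin_le_one _) hN.le
  have hpb : ∀ x, |p x| ≤ (√e)⁻¹ := fun x => by
    rw [abs_of_nonneg (gaussianPDFReal_nonneg _ _ _)]
    exact (gaussianPDFReal_le a hv x).trans
      (inv_anti₀ (Real.sqrt_pos.2 he) (Real.sqrt_le_sqrt hev))
  have hp'b : ∀ x, |p' x| ≤ e⁻¹ := fun x =>
    (abs_deriv_gaussianPDFReal_le a hv x).trans (inv_anti₀ he hev)
  have hb : ∀ x, |p x * (Real.sin (N * x) / N)| ≤ (√e)⁻¹ * (1 / N) := fun x => by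
    rw [abs_mul]
    exact mul_le_mul (hpb x) (hs x) (abs_nonneg _) (by positivity)
  have hI : |∫ x in l..r, p' x * (Real.sin (N * x) / N)| ≤ e⁻¹ * (1 / N) * (r - l) := by
    have := intervalIntegral.norm_integral_le_of_norm_le_const (a := l) (b := r)
      (f := fun x => p' x * (Real.sin (N * x) / N)) (C := e⁻¹ * (1 / N)) fun x _ => by
        rw [norm_mul]
        exact mul_le_mul (hp'b x) (hs x) (norm_nonneg _) (by positivity)
    rwa [abs_of_nonneg (sub_nonneg.2 hlr), Real.norm_eq_abs] at this
  calc _ ≤ |p r * (Real.sin (N * r) / N)| + |p l * (Real.sin (N * l) / N)|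
        + |∫ x in l..r, p' x * (Real.sin (N * x) / N)| :=
        (abs_sub _ _).trans (add_le_add (abs_sub _ _) le_rfl)
    _ ≤ (√e)⁻¹ * (1 / N) + (√e)⁻¹ * (1 / N) + e⁻¹ * (1 / N) * (r - l) :=
        add_le_add (add_le_add (hb r) (hb l)) hI
    _ = _ := by field_simp; ring

/-- The Riemann-Lebesgue lemma for cosines. -/
lemma tendsto_integral_cos_mul {ψ : ℝ → ℝ} (hψ : Integrable ψ) {c : ℝ} (hc : 0 < c) :
    Tendsto (fun N : ℕ => ∫ x, Real.cos (c * N * x) * ψ x) atTop (𝓝 0) := by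
  have h := Real.tendsto_integral_exp_smul_cocompact (fun x => (ψ x : ℂ))
  -- The factor `2 π` compensates for the normalisation of the Fourier character.
  have hw : Tendsto (fun N : ℕ => c * N / (2 * Real.pi)) atTop (cocompact ℝ) := by
    refine (Tendsto.atTop_div_const (by positivity)
      (tendsto_natCast_atTop_atTop.const_mul_atTop hc)).mono_right atTop_le_cocompact
  have h2 := (Complex.continuous_re.tendsto _).comp (h.comp hw)
  simp only [Complex.zero_re] at h2
  refine h2.congr fun N => ?_
  simp only [Function.comp_apply]
  have hint : Integrable fun x : ℝ => Real.fourierChar (-(x * (c * N / (2 * Real.pi)))) • (ψ x : ℂ) := by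
    have := (Real.fourierIntegral_convergent_iff (f := fun x : ℝ => (ψ x : ℂ)) (μ := volume)
      (c * N / (2 * Real.pi))).2 hψ.ofReal
    convert! this using 4
    simp [mul_comm]
  have h3 := (Complex.reCLM.integral_comp_comm hint)
  simp only [Complex.reCLM_apply] at h3
  rw [← h3]
  congr 1; ext x
  rw [Circle.smul_def, Real.fourierChar_apply, smul_eq_mul, Complex.re_mul_ofReal,
    Complex.exp_ofReal_mul_I_re]
  congr 1
  rw [← Real.cos_neg]
  congr 1
  field_simp

/-! ### The oscillating function -/

/-- A smooth cutoff that equals `1` on `[4 k - 1, 4 k + 1]` and vanishes outside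
`(4 k - 2, 4 k + 2)`. -/
noncomputable def cutoff (k : ℕ) : ContDiffBump (4 * k : ℝ) where
  rIn := 1
  rOut := 2
  rIn_pos := one_pos
  rIn_lt_rOut := one_lt_two

/-- A smooth function that oscillates with frequency `N k` on `[4 k - 1, 4 k + 1]`. -/
noncomputable def oscillation (N : ℕ → ℕ) (x : ℝ) : ℝ :=
  ∑ᶠ k, cutoff k x * ((1 + Real.cos (N k * x)) / 4)

lemma support_cutoff_mul (N : ℕ → ℕ) (k : ℕ) :
    Function.support (fun x => cutoff k x * ((1 + Real.cos (N k * x)) / 4))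
      ⊆ Metric.ball (4 * k : ℝ) 2 :=
  (Function.support_mul_subset_left _ _).trans (cutoff k).support_eq.subset

lemma contDiff_oscillation (N : ℕ → ℕ) : ContDiff ℝ (⊤ : ℕ∞) (oscillation N) := by
  rw [← contMDiff_iff_contDiff]
  refine contMDiff_finsum (fun k => ?_) fun x => ?_
  · rw [contMDiff_iff_contDiff]
    exact (cutoff k).contDiff.mul (by fun_prop)
  · refine ⟨Metric.ball x 1, Metric.ball_mem_nhds x one_pos,
      (finite_Iic ⌈x + 3⌉₊).subset fun k hk => ?_⟩
    obtain ⟨y, hy1, hy2⟩ := hk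
    have h1 := support_cutoff_mul N k hy1
    rw [Metric.mem_ball, Real.dist_eq, abs_lt] at h1 hy2
    have h2 : (k : ℝ) ≤ x + 3 := by
      have : (0 : ℝ) ≤ k := k.cast_nonneg
      linarith [h1.1, hy2.2]
    exact_mod_cast h2.trans (Nat.le_ceil _)

/-- The balls of radius `2` about the multiples of `4` are disjoint, so only one summand survives.
-/
lemma oscillation_eq_of_mem_ball (N : ℕ → ℕ) {k : ℕ} {x : ℝ}
    (hx : x ∈ Metric.ball (4 * k : ℝ) 2) :
    oscillation N x = cutoff k x * ((1 + Real.cos (N k * x)) / 4) := by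
  refine finsum_eq_single _ k fun l hl => ?_
  by_contra h
  have h1 := support_cutoff_mul N l h
  rw [Metric.mem_ball, Real.dist_eq, abs_lt] at h1 hx
  have h2 : (k : ℝ) < l + 1 := by linarith [h1.1, h1.2, hx.1, hx.2]
  have h3 : (l : ℝ) < k + 1 := by linarith [h1.1, h1.2, hx.1, hx.2]
  have h4 : k < l + 1 := by exact_mod_cast h2
  have h5 : l < k + 1 := by exact_mod_cast h3
  omega

lemma oscillation_eq_of_mem_Icc (N : ℕ → ℕ) {k : ℕ} {x : ℝ}
    (hx : x ∈ Icc (4 * k - 1 : ℝ) (4 * k + 1)) :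
    oscillation N x = (1 + Real.cos (N k * x)) / 4 := by
  have h1 : |x - 4 * k| ≤ 1 := abs_le.2 ⟨by linarith [hx.1], by linarith [hx.2]⟩
  rw [oscillation_eq_of_mem_ball N (k := k), (cutoff k).one_of_mem_closedBall, one_mul]
  · rwa [Metric.mem_closedBall, Real.dist_eq]
  · rw [Metric.mem_ball, Real.dist_eq]
    linarith

lemma oscillation_mem (N : ℕ → ℕ) (x : ℝ) : oscillation N x ∈ Icc (0 : ℝ) (1 / 2) := by
  by_cases h : ∃ k : ℕ, x ∈ Metric.ball (4 * k : ℝ) 2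
  · obtain ⟨k, hk⟩ := h
    rw [oscillation_eq_of_mem_ball N hk]
    have h1 := (cutoff k).nonneg (x := x)
    have h2 := (cutoff k).le_one (x := x)
    have h3 := Real.neg_one_le_cos (N k * x)
    have h4 := Real.cos_le_one (N k * x)
    refine ⟨mul_nonneg h1 (by linarith), ?_⟩
    calc _ ≤ 1 * ((1 + Real.cos (N k * x)) / 4) := mul_le_mul_of_nonneg_right h2 (by linarith)
      _ ≤ _ := by linarith
  · have : oscillation N x = 0 := by
      refine finsum_eq_zero_of_forall_eq_zero fun k => ?_
      by_contra h'
      exact h ⟨k, support_cutoff_mul N k h'⟩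
    rw [this]
    norm_num

lemma gaussianReal_real_Icc_pos (c : ℝ) {v : NNReal} (hv : v ≠ 0) {l r : ℝ} (hlr : l < r) :
    0 < (gaussianReal c v).real (Icc l r) := by
  refine ENNReal.toReal_pos (fun h => ?_) (measure_ne_top _ _)
  have := gaussianReal_absolutelyContinuous' c hv h
  rw [Real.volume_Icc, ENNReal.ofReal_eq_zero] at this
  linarith

lemma tendsto_setIntegral_cos_mul_gaussianReal (c : ℝ) {v : NNReal} (hv : v ≠ 0) (l r : ℝ)
    {q : ℝ → ℝ} (hq : Continuous q) {w : ℝ} (hw : 0 < w) :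
    Tendsto (fun N : ℕ => ∫ x in Icc l r, Real.cos (w * N * x) * q x ∂(gaussianReal c v)) atTop
      (𝓝 0) := by
  have hpc : Continuous (gaussianPDFReal c v) :=
    continuous_iff_continuousAt.2 fun x => (hasDerivAt_gaussianPDFReal c hv x).continuousAt
  have hint : Integrable ((Icc l r).indicator fun x => gaussianPDFReal c v x * q x) :=
    (integrable_indicator_iff measurableSet_Icc).2
      ((hpc.mul hq).continuousOn.integrableOn_Icc)
  refine (tendsto_integral_cos_mul hint hw).congr fun N => ?_
  rw [← integral_indicator measurableSet_Icc, integral_gaussianReal_eq_integral_smul hv]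
  congr 1; ext x
  by_cases hx : x ∈ Icc l r
  · rw [indicator_of_mem hx, indicator_of_mem hx, smul_eq_mul]; ring
  · rw [indicator_of_notMem hx, indicator_of_notMem hx, smul_zero, mul_zero]

/-- On `[l, r]`, an oscillation correlates with itself. -/
lemma tendsto_setIntegral_oscillation_mul_cos (c : ℝ) {v : NNReal} (hv : v ≠ 0) (l r m M : ℝ) :
    Tendsto (fun N : ℕ => ∫ x in Icc l r, (x + m + M * ((1 + Real.cos (N * x)) / 4)) *
      Real.cos (N * x) ∂(gaussianReal c v)) atTop (𝓝 (M / 8 * (gaussianReal c v).real (Icc l r))) := by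
  -- Since `cos² = (1 + cos 2·) / 2`, the integrand is the constant `M / 8` plus oscillations of
  -- frequencies `N` and `2 N`, which vanish in the limit.
  have h1 := tendsto_setIntegral_cos_mul_gaussianReal c hv l r
    (q := fun x => x + m + M / 4) (by fun_prop) one_pos
  have h2 := tendsto_setIntegral_cos_mul_gaussianReal c hv l r
    (q := fun _ => M / 8) (by fun_prop) two_pos
  have h3 := (h1.add h2).add_const (M / 8 * (gaussianReal c v).real (Icc l r))
  rw [add_zero, zero_add] at h3
  refine h3.congr fun N => ?_
  have hi : ∀ {φ : ℝ → ℝ}, Continuous φ → IntegrableOn φ (Icc l r) (gaussianReal c v) := fun hφ =>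
    hφ.continuousOn.integrableOn_compact isCompact_Icc
  have h4 : M / 8 * (gaussianReal c v).real (Icc l r) = ∫ _ in Icc l r, M / 8 ∂(gaussianReal c v) := by
    rw [setIntegral_const, smul_eq_mul, mul_comm]
  rw [h4, ← integral_add (hi (by fun_prop)) (hi (by fun_prop)),
    ← integral_add (hi (by fun_prop)) (hi (by fun_prop))]
  congr 1; ext x
  have : Real.cos (2 * N * x) = 2 * Real.cos (N * x) ^ 2 - 1 := by
    rw [mul_assoc, Real.cos_two_mul]
  rw [this, one_mul]
  ring

/-- There is a smooth bounded function `h` such that `x + m + M h(x)` is far from the functions of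
`U`, if `x = α U + B` is a Gaussian variable with `B` Gaussian and independent of `U`. The loss is
of order `P(x ∈ [4 k - 1, 4 k + 1])` if the variance of `B` is at least `e k`. -/
theorem exists_oscillation_test (c : ℝ) {v : NNReal} (hv : v ≠ 0) (m : ℝ) {M : ℝ} (hM : 0 < M)
    {e : ℕ → ℝ} (he : ∀ k, 0 < e k) :
    ∃ h : ℝ → ℝ, ContDiff ℝ (⊤ : ℕ∞) h ∧ (∀ x, h x ∈ Icc (0 : ℝ) (1 / 2)) ∧
      Integrable (fun x => x + m + M * h x) (gaussianReal c v) ∧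
      ∀ k : ℕ, ∃ (s : ℝ → ℝ) (q : ℝ), Measurable s ∧ (∀ x, |s x| ≤ 1) ∧
        (∀ β : NNReal, e k ≤ β → ∀ a, |∫ b, s (a + b) ∂(gaussianReal 0 β)| ≤ q) ∧
        M / 64 * (gaussianReal c v).real (Icc (4 * k - 1) (4 * k + 1))
          ≤ 1 / 2 * (∫ x, (x + m + M * h x) * s x ∂(gaussianReal c v)
            - q * ∫ x, |x + m + M * h x| ∂(gaussianReal c v)) := by
  set γ := gaussianReal c v with hγ
  have hid : Integrable (fun x => x) γ := (memLp_id_gaussianReal 1).integrable le_rfl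
  -- A bound for the mean of `|x + m + M h|` that uses only `0 ≤ h ≤ 1 / 2`. It does not involve the
  -- frequencies, so each `N k` can be chosen separately.
  set R := (∫ x, |x| ∂γ) + |m| + M / 2 with hR
  have hR0 : 0 < R := by
    have : 0 ≤ ∫ x, |x| ∂γ := integral_nonneg fun _ => abs_nonneg _
    positivity
  have hp : ∀ k : ℕ, 0 < γ.real (Icc (4 * k - 1 : ℝ) (4 * k + 1)) := fun k =>
    gaussianReal_real_Icc_pos c hv (by linarith)
  -- The correlation tends to `M / 8` times the probability, so `M / 16` is eventually exceeded.
  -- With error at most `M / 32`, half the difference leaves `M / 64`.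
  have hex : ∀ k : ℕ, ∃ N : ℕ, 0 < N ∧
      M / 16 * γ.real (Icc (4 * k - 1 : ℝ) (4 * k + 1))
        ≤ ∫ x in Icc (4 * k - 1 : ℝ) (4 * k + 1), (x + m + M * ((1 + Real.cos (N * x)) / 4)) *
          Real.cos (N * x) ∂γ ∧
      (2 * (√(e k))⁻¹ + (e k)⁻¹ * (4 * k + 1 - (4 * k - 1))) / N * R
        ≤ M / 32 * γ.real (Icc (4 * k - 1 : ℝ) (4 * k + 1)) := by
    intro k
    have h1 : ∀ᶠ N : ℕ in atTop, M / 16 * γ.real (Icc (4 * k - 1 : ℝ) (4 * k + 1))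
        ≤ ∫ x in Icc (4 * k - 1 : ℝ) (4 * k + 1), (x + m + M * ((1 + Real.cos (N * x)) / 4)) *
          Real.cos (N * x) ∂γ := by
      refine (tendsto_setIntegral_oscillation_mul_cos c hv _ _ m M).eventually_const_le ?_
      have := mul_pos hM (hp k)
      rw [hγ] at this ⊢
      linarith
    have h2 : Tendsto (fun N : ℕ => (2 * (√(e k))⁻¹ + (e k)⁻¹ * (4 * k + 1 - (4 * k - 1))) / N * R)
        atTop (𝓝 0) := by
      simpa using (tendsto_const_div_atTop_nhds_zero_nat _).mul_const R
    have h3 := h2.eventually_le_const (mul_pos (by positivity : 0 < M / 32) (hp k))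
    obtain ⟨N, hN⟩ := (h1.and (h3.and (eventually_gt_atTop 0))).exists
    exact ⟨N, hN.2.2, hN.1, hN.2.1⟩
  choose N hN0 hN1 hN2 using hex
  have hhm := oscillation_mem N
  have hhc : Continuous (oscillation N) := (contDiff_oscillation N).continuous
  have hho : Integrable (fun x => M * oscillation N x) γ :=
    (Integrable.of_bound hhc.aestronglyMeasurable (1 / 2) (ae_of_all _ fun x => by
      rw [Real.norm_eq_abs, abs_of_nonneg (hhm x).1]; exact (hhm x).2)).const_mul M
  have hFint : Integrable (fun x => x + m + M * oscillation N x) γ :=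
    (hid.add (integrable_const m)).add hho
  have hFR : ∫ x, |x + m + M * oscillation N x| ∂γ ≤ R := by
    have h1 : ∫ x, (|x| + (|m| + M / 2)) ∂γ = R := by
      rw [integral_add hid.abs (integrable_const _), integral_const, hR]
      simp; ring
    rw [← h1]
    refine integral_mono hFint.abs (hid.abs.add (integrable_const _)) fun x => ?_
    have h2 : |M * oscillation N x| ≤ M / 2 := by
      rw [abs_of_nonneg (mul_nonneg hM.le (hhm x).1)]
      nlinarith [(hhm x).2]
    have h3 := abs_add_le (x + m) (M * oscillation N x)
    have h4 := abs_add_le x m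
    simp only
    linarith
  refine ⟨oscillation N, contDiff_oscillation N, hhm, hFint, fun k => ?_⟩
  set J := Icc (4 * k - 1 : ℝ) (4 * k + 1) with hJ
  refine ⟨J.indicator fun x => Real.cos (N k * x),
    (2 * (√(e k))⁻¹ + (e k)⁻¹ * (4 * k + 1 - (4 * k - 1))) / N k,
    Measurable.indicator (by fun_prop) measurableSet_Icc, fun x => ?_, fun β hβ a => ?_, ?_⟩
  · by_cases hx : x ∈ J
    · rw [indicator_of_mem hx]; exact Real.abs_cos_le_one _
    · rw [indicator_of_notMem hx]; simp
  · exact abs_integral_cos_gaussianReal_le (by linarith) (by exact_mod_cast hN0 k) (he k) hβ a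
  · have h1 : ∫ x, (x + m + M * oscillation N x) * J.indicator (fun x => Real.cos (N k * x)) x ∂γ
        = ∫ x in J, (x + m + M * ((1 + Real.cos (N k * x)) / 4)) * Real.cos (N k * x) ∂γ := by
      rw [← integral_indicator measurableSet_Icc]
      congr 1; ext x
      by_cases hx : x ∈ J
      · rw [indicator_of_mem hx, indicator_of_mem hx, oscillation_eq_of_mem_Icc N hx]
      · rw [indicator_of_notMem hx, indicator_of_notMem hx, mul_zero]
    have hq0 : 0 ≤ (2 * (√(e k))⁻¹ + (e k)⁻¹ * (4 * k + 1 - (4 * k - 1))) / N k := by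
      have := he k
      have h4 : (4 * k + 1 - (4 * k - 1) : ℝ) = 2 := by ring
      rw [h4]
      positivity
    have h2 := mul_le_mul_of_nonneg_left hFR hq0
    rw [h1]
    linarith [hN1 k, hN2 k]

/-! ### Choice of thresholds -/

/-- Sorting a sequence with nonpositive limes superior into countably many finite classes. -/
lemma exists_threshold {c : ℕ → ℝ} (hc : ∀ k, 0 < c k) {ε δ : ℕ → ℝ} (hε : ∀ n, 0 < ε n)
    (hδ : ∀ η > 0, ∀ᶠ n in atTop, δ n ≤ η) (hδ0 : ∀ n, δ n ≤ c 0) :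
    ∃ e : ℕ → ℝ, (∀ k, 0 < e k) ∧ ∀ n, ∃ k, e k ≤ ε n ∧ δ n ≤ c k := by
  classical
  have hfin : ∀ k, {n | n ≤ k ∨ c (k + 1) < δ n}.Finite := by
    intro k
    refine (finite_Iic k).union ?_
    obtain ⟨n₀, hn₀⟩ := eventually_atTop.1 (hδ _ (hc (k + 1)))
    refine (finite_Iio n₀).subset fun n hn => ?_
    by_contra h
    exact absurd (hn₀ n (not_lt.1 h)) (not_le.2 hn)
  have hmin : ∀ k, ∃ e > 0, ∀ n ∈ {n | n ≤ k ∨ c (k + 1) < δ n}, e ≤ ε n := by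
    intro k
    obtain ⟨n, -, hn⟩ := exists_min_image _ ε (hfin k) ⟨0, Or.inl (Nat.zero_le k)⟩
    exact ⟨ε n, hε n, hn⟩
  choose e he0 he using hmin
  refine ⟨e, he0, fun n => ?_⟩
  -- Take the first class containing `n`: absence from the preceding class gives `δ n ≤ c k`, and
  -- for `k = 0` the bound is `hδ0`. The condition `n ≤ k` ensures that every `n` is eventually
  -- included.
  have hex : ∃ k, n ≤ k ∨ c (k + 1) < δ n := ⟨n, Or.inl le_rfl⟩
  refine ⟨Nat.find hex, he _ n (Nat.find_spec hex), ?_⟩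
  rcases hk : Nat.find hex with _ | k
  · exact hδ0 n
  · have := Nat.find_min hex (m := k) (by omega)
    push Not at this
    exact this.2

/-! ### Measurability of path-valued maps -/

section Paths

variable {Ω : Type*} {T : ℝ}

/-- Evaluation on a countable dense set is a continuous injection of a Polish space, hence a
measurable embedding (Lusin-Souslin). So measurability may be tested at single times. -/
lemma measurable_path {mΩ : MeasurableSpace Ω} {V : Icc (0 : ℝ) T → Ω → ℝ}
    (hV : ∀ s, Measurable (V s)) (hVc : ∀ ω, Continuous fun s => V s ω) :
    Measurable[mΩ, borel C(Icc (0 : ℝ) T, ℝ)] (path V hVc) := by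
  let _ : MeasurableSpace C(Icc (0 : ℝ) T, ℝ) := borel _
  have _ : BorelSpace C(Icc (0 : ℝ) T, ℝ) := ⟨rfl⟩
  obtain ⟨s, hs, hd⟩ := TopologicalSpace.exists_countable_dense (Icc (0 : ℝ) T)
  have := hs.to_subtype
  have hemb : MeasurableEmbedding fun (w : C(Icc (0 : ℝ) T, ℝ)) (x : s) => w x := by
    refine Continuous.measurableEmbedding (by fun_prop) fun w w' hww' => ?_
    refine DFunLike.coe_injective (Continuous.ext_on hd w.continuous w'.continuous fun x hx => ?_)
    exact congrFun hww' ⟨x, hx⟩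
  rw [← hemb.measurable_comp_iff]
  exact measurable_pi_lambda _ fun x => hV x

lemma weightedIntegral_add_smul {g : ℝ → ℝ} (hg : Continuous g) (w w' : C(Icc (0 : ℝ) T, ℝ))
    (r : ℝ) : weightedIntegral g (w + r • w') = weightedIntegral g w + weightedIntegral g w' * r := by
  have hint : ∀ w : C(Icc (0 : ℝ) T, ℝ),
      Integrable (fun s : Icc (0 : ℝ) T => g s * w s) (lebesgue T) := fun w =>
    (((hg.comp continuous_subtype_val).mul w.continuous)).integrable_of_hasCompactSupport
      (HasCompactSupport.of_compactSpace _)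
  rw [weightedIntegral, weightedIntegral, weightedIntegral, ← integral_mul_const,
    ← integral_add (hint w) ((hint w').mul_const r)]
  congr 1; ext s
  simp
  ring

end Paths

/-! ### The Gaussian variable hidden inside an interval -/

/-- The tent function with basis `[a, b]`, the covariance function of the Brownian motion with
`W ((a + b) / 2) - (W a + W b) / 2`. -/
noncomputable def tent (a b s : ℝ) : ℝ := min s ((a + b) / 2) - (min s a + min s b) / 2

lemma continuous_tent (a b : ℝ) : Continuous (tent a b) := by
  unfold tent; fun_prop

lemma tent_of_le {a b s : ℝ} (hab : a ≤ b) (hs : s ≤ a) : tent a b s = 0 := by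
  rw [tent, min_eq_left (by linarith), min_eq_left hs, min_eq_left (by linarith)]
  ring

lemma tent_of_ge {a b s : ℝ} (hab : a ≤ b) (hs : b ≤ s) : tent a b s = 0 := by
  rw [tent, min_eq_right (by linarith), min_eq_right (by linarith), min_eq_right hs]
  ring

lemma tent_of_mem {a b s : ℝ} (has : a ≤ s) (hsb : s ≤ (a + b) / 2) : tent a b s = (s - a) / 2 := by
  rw [tent, min_eq_left hsb, min_eq_right has, min_eq_left (by linarith)]
  ring

lemma tent_nonneg {a b : ℝ} (hab : a ≤ b) (s : ℝ) : 0 ≤ tent a b s := by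
  rcases le_total s a with h | h
  · rw [tent_of_le hab h]
  rcases le_total s ((a + b) / 2) with h1 | h1
  · rw [tent_of_mem h h1]; linarith
  rcases le_total s b with h2 | h2
  · rw [tent, min_eq_right h1, min_eq_right h, min_eq_left h2]; linarith
  · rw [tent_of_ge hab h2]

lemma tent_mid {a b : ℝ} (hab : a ≤ b) : tent a b ((a + b) / 2) = (b - a) / 4 := by
  rw [tent_of_mem (by linarith) le_rfl]; ring

section Hidden

variable {Ω : Type*} {mΩ : MeasurableSpace Ω} {T : ℝ} {P : Measure Ω}
  {𝓕 : Filtration (Icc (0 : ℝ) T) mΩ} {W : Icc (0 : ℝ) T → Ω → ℝ}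

/-- The midpoint. -/
noncomputable def mid (a b : Icc (0 : ℝ) T) : Icc (0 : ℝ) T :=
  ⟨((a : ℝ) + b) / 2, by linarith [a.2.1, b.2.1], by linarith [a.2.2, b.2.2]⟩

/-- The tent function as a path. -/
noncomputable def tentPath (a b : Icc (0 : ℝ) T) : C(Icc (0 : ℝ) T, ℝ) :=
  ⟨fun s => tent a b s, (continuous_tent a b).comp continuous_subtype_val⟩

/-- The deviation of `W` at the midpoint of `[a, b]` from its linear interpolation. -/
noncomputable def deviation (W : Icc (0 : ℝ) T → Ω → ℝ) (a b : Icc (0 : ℝ) T) (ω : Ω) : ℝ :=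
  W (mid a b) ω - (W a ω + W b ω) / 2

/-- The part of `W` that is independent of its deviation at the midpoint of `[a, b]`. -/
noncomputable def residual (W : Icc (0 : ℝ) T → Ω → ℝ) (a b s : Icc (0 : ℝ) T) (ω : Ω) : ℝ :=
  W s ω - tent a b s / (((b : ℝ) - a) / 4) * deviation W a b ω

lemma continuous_residual (hc : ∀ ω, Continuous fun s => W s ω) (a b : Icc (0 : ℝ) T) (ω : Ω) :
    Continuous fun s => residual W a b s ω :=
  (hc ω).sub ((((continuous_tent a b).comp continuous_subtype_val).div_const _).mul
    continuous_const)

lemma path_eq_residual (hc : ∀ ω, Continuous fun s => W s ω) (a b : Icc (0 : ℝ) T) (ω : Ω) :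
    path W hc ω = path (residual W a b) (continuous_residual hc a b) ω
      + (deviation W a b ω / (((b : ℝ) - a) / 4)) • tentPath a b := by
  ext s
  simp only [path, residual, tentPath, ContinuousMap.add_apply, ContinuousMap.smul_apply,
    ContinuousMap.coe_mk, smul_eq_mul]
  ring

/-- The tent vanishes outside `(a, b)`. Thus every observation outside this interval is a function
of the residual. -/
lemma restrict_path_eq (hc : ∀ ω, Continuous fun s => W s ω) {a b : Icc (0 : ℝ) T} (hab : a ≤ b)
    (ω : Ω) : (path W hc ω).restrict (Iic a ∪ Ici b)
      = (path (residual W a b) (continuous_residual hc a b) ω).restrict (Iic a ∪ Ici b) := by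
  have hab' : (a : ℝ) ≤ b := hab
  ext ⟨s, hs⟩
  have h0 : tent a b s = 0 := by
    rcases hs with h | h
    · exact tent_of_le hab' h
    · exact tent_of_ge hab' h
  simp [path, residual, h0]

namespace IsBrownianMotion

lemma measurable_deviation (hW : IsBrownianMotion P 𝓕 W) (a b : Icc (0 : ℝ) T) :
    Measurable (deviation W a b) :=
  (hW.measurable _).sub (((hW.measurable _).add (hW.measurable _)).div_const 2)

lemma measurable_residual (hW : IsBrownianMotion P 𝓕 W) (a b s : Icc (0 : ℝ) T) :
    Measurable (residual W a b s) :=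
  (hW.measurable _).sub ((hW.measurable_deviation a b).const_mul _)

lemma memLp_deviation (hW : IsBrownianMotion P 𝓕 W) (hT : 0 ≤ T) (a b : Icc (0 : ℝ) T) :
    MemLp (deviation W a b) 2 P := by
  have := (hW.memLp_eval hT (mid a b)).sub
    (((hW.memLp_eval hT a).add (hW.memLp_eval hT b)).const_mul (1 / 2))
  refine this.ae_eq (ae_of_all _ fun ω => ?_)
  simp [deviation]
  ring

variable [IsProbabilityMeasure P]

lemma covariance_eval_deviation (hW : IsBrownianMotion P 𝓕 W) (hT : 0 ≤ T)
    (a b s : Icc (0 : ℝ) T) : cov[W s, deviation W a b; P] = tent a b s := by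
  have h : deviation W a b = W (mid a b) - fun ω => (1 / 2 : ℝ) * (W a + W b) ω := by
    ext ω; simp [deviation]; ring
  have hm := hW.memLp_eval hT
  rw [h, covariance_sub_right (hm s) (hm _) (((hm a).add (hm b)).const_mul (1 / 2)),
    covariance_const_mul_right, covariance_add_right (hm s) (hm a) (hm b),
    hW.covariance_eval hT, hW.covariance_eval hT, hW.covariance_eval hT, tent]
  simp only [mid]
  ring

lemma covariance_deviation_self (hW : IsBrownianMotion P 𝓕 W) (hT : 0 ≤ T)
    {a b : Icc (0 : ℝ) T} (hab : a ≤ b) :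
    cov[deviation W a b, deviation W a b; P] = ((b : ℝ) - a) / 4 := by
  have hab' : (a : ℝ) ≤ b := hab
  have h : deviation W a b = W (mid a b) - fun ω => (1 / 2 : ℝ) * (W a + W b) ω := by
    ext ω; simp [deviation]; ring
  have hm := hW.memLp_eval hT
  have hD := hW.memLp_deviation hT a b
  have h1 : cov[deviation W a b, deviation W a b; P]
      = cov[W (mid a b) - fun ω => (1 / 2 : ℝ) * (W a + W b) ω, deviation W a b; P] := by rw [← h]
  rw [h1, covariance_sub_left (hm _) (((hm a).add (hm b)).const_mul (1 / 2)) hD,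
    covariance_const_mul_left, covariance_add_left (hm a) (hm b) hD,
    hW.covariance_eval_deviation hT, hW.covariance_eval_deviation hT,
    hW.covariance_eval_deviation hT, tent_of_le hab' le_rfl, tent_of_ge hab' le_rfl]
  simp only [mid, tent_mid hab']
  ring

/-- The coefficient subtracted in `residual` is the regression coefficient: the covariance `tent a b
s` over the variance `(b - a) / 4`. -/
lemma covariance_residual_deviation (hW : IsBrownianMotion P 𝓕 W) (hT : 0 ≤ T)
    {a b : Icc (0 : ℝ) T} (hab : a < b) (s : Icc (0 : ℝ) T) :
    cov[residual W a b s, deviation W a b; P] = 0 := by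
  have hab' : (a : ℝ) < b := hab
  have hD := hW.memLp_deviation hT a b
  have h : residual W a b s
      = W s - fun ω => tent a b s / (((b : ℝ) - a) / 4) * deviation W a b ω := rfl
  rw [h, covariance_sub_left (hW.memLp_eval hT s) (hD.const_mul _) hD, covariance_const_mul_left,
    hW.covariance_eval_deviation hT, hW.covariance_deviation_self hT hab.le]
  field_simp [show (b : ℝ) - a ≠ 0 by linarith]
  ring

lemma isGaussianProcess_residual_deviation (hW : IsBrownianMotion P 𝓕 W) (hT : 0 ≤ T)
    (a b : Icc (0 : ℝ) T) :
    IsGaussianProcess (Sum.elim (residual W a b) fun _ : Unit => deviation W a b) P := by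
  classical
  refine IsGaussianProcess.of_isGaussianProcess (hW.isGaussianProcess hT) ?_
  have hmem : ∀ s : Icc (0 : ℝ) T, mid a b ∈ ({s, mid a b, a, b} : Finset _) ∧
      a ∈ ({s, mid a b, a, b} : Finset _) ∧ b ∈ ({s, mid a b, a, b} : Finset _) ∧
      s ∈ ({s, mid a b, a, b} : Finset _) := fun s => by simp
  let p : ∀ s : Icc (0 : ℝ) T, ∀ x : ({s, mid a b, a, b} : Finset (Icc (0 : ℝ) T)),
    ((({s, mid a b, a, b} : Finset (Icc (0 : ℝ) T))) → ℝ) →L[ℝ] ℝ := fun s x =>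
      ContinuousLinearMap.proj x
  let D : ∀ s : Icc (0 : ℝ) T, ((({s, mid a b, a, b} : Finset (Icc (0 : ℝ) T))) → ℝ) →L[ℝ] ℝ :=
    fun s => p s ⟨mid a b, (hmem s).1⟩ - (1 / 2 : ℝ) • (p s ⟨a, (hmem s).2.1⟩ +
      p s ⟨b, (hmem s).2.2.1⟩)
  rintro (s | _)
  · refine ⟨{s, mid a b, a, b}, p s ⟨s, (hmem s).2.2.2⟩ -
      (tent a b s / (((b : ℝ) - a) / 4)) • D s, fun ω => ?_⟩
    simp [p, D, residual, deviation]
    left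
    ring
  · refine ⟨{a, mid a b, a, b}, D a, fun ω => ?_⟩
    simp [p, D, deviation]
    ring

lemma hasLaw_deviation (hW : IsBrownianMotion P 𝓕 W) (hT : 0 ≤ T)
    {a b : Icc (0 : ℝ) T} (hab : a ≤ b) :
    HasLaw (deviation W a b) (gaussianReal 0 (((b : ℝ) - a) / 4).toNNReal) P := by
  have hG : HasGaussianLaw (deviation W a b) P :=
    (hW.isGaussianProcess_residual_deviation hT a b).hasGaussianLaw_eval (Sum.inr ())
  have hmean : ∀ s, P[W s] = 0 := fun s => by
    rw [(hW.hasLaw_eval hT s).integral_eq, integral_id_gaussianReal]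
  have hint : ∀ s, Integrable (W s) P := fun s => (hW.memLp_eval hT s).integrable one_le_two
  have h0 : P[deviation W a b] = 0 := by
    simp only [deviation]
    rw [MeasureTheory.integral_sub (g := fun ω => (W a ω + W b ω) / 2) (hint _) (((hint a).add (hint b)).div_const 2), hmean,
      integral_div, integral_add (hint a) (hint b), hmean, hmean]
    simp
  refine ⟨hG.aemeasurable, ?_⟩
  rw [hG.isGaussian_map.eq_gaussianReal, variance_map (by fun_prop) hG.aemeasurable,
    integral_map hG.aemeasurable (by fun_prop)]
  have h1 : Var[deviation W a b; P] = ((b : ℝ) - a) / 4 := by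
    rw [← covariance_self hG.aemeasurable, hW.covariance_deviation_self hT hab]
  simp only [id_eq, h0, Function.id_comp, h1]

/-- Residual and deviation are jointly Gaussian and uncorrelated, hence independent for the product
σ-algebra; `measurable_path` transfers this to the Borel σ-algebra of paths. -/
lemma indepFun_residual_deviation (hW : IsBrownianMotion P 𝓕 W) (hT : 0 ≤ T)
    {a b : Icc (0 : ℝ) T} (hab : a < b) :
    @IndepFun Ω C(Icc (0 : ℝ) T, ℝ) ℝ mΩ (borel _) inferInstance
      (path (residual W a b) (continuous_residual hW.continuous_paths a b)) (deviation W a b) P := by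
  have h := (hW.isGaussianProcess_residual_deviation hT a b).indepFun_of_covariance_eq_zero
    (fun s => (hW.measurable_residual a b s).aemeasurable)
    (fun _ => (hW.measurable_deviation a b).aemeasurable)
    fun s _ => hW.covariance_residual_deviation hT hab s
  have h2 := h.comp measurable_id (measurable_pi_apply ())
  refine indep_of_indep_of_le_left h2 ?_
  refine Measurable.comap_le ?_
  refine measurable_path (fun s => ?_) _
  exact (measurable_pi_apply s).comp (comap_measurable (id ∘ fun ω s => residual W a b s ω))

/-- The distance in mean of a function of a Wiener integral from the functions of `W` outside
`(a, b)`. -/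
theorem le_lintegral_sub_restrict (hW : IsBrownianMotion P 𝓕 W) (hT : 0 ≤ T)
    {f g : ℝ → ℝ} (hfg : ∀ x, HasDerivAt f (-g x) x)
    (hg : Continuous g) {C : ℝ} (hC : ∀ x, |f x| ≤ C) (hfT : f T = 0)
    {a b : Icc (0 : ℝ) T} (hab : a < b) {z q : ℝ} {F s : ℝ → ℝ}
    (hs : Measurable s) (hs1 : ∀ x, |s x| ≤ 1)
    (hF : Integrable F (gaussianReal z (wienerVariance T f)))
    (hq : ∀ β : NNReal, (weightedIntegral g (tentPath a b)) ^ 2 / (((b : ℝ) - a) / 4) = β →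
      ∀ x, |∫ y, s (x + y) ∂(gaussianReal 0 β)| ≤ q)
    {u : C(↥(Iic a ∪ Ici b), ℝ) → ℝ} (hu : Measurable[borel C(↥(Iic a ∪ Ici b), ℝ)] u) :
    ENNReal.ofReal (1 / 2 * (∫ x, F x * s x ∂(gaussianReal z (wienerVariance T f))
        - q * ∫ x, |F x| ∂(gaussianReal z (wienerVariance T f))))
      ≤ ∫⁻ ω, ‖F (z + weightedIntegral g (path W hW.continuous_paths ω))
          - u ((path W hW.continuous_paths ω).restrict (Iic a ∪ Ici b))‖ₑ ∂P := by
  let _ : MeasurableSpace C(Icc (0 : ℝ) T, ℝ) := borel _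
  have _ : BorelSpace C(Icc (0 : ℝ) T, ℝ) := ⟨rfl⟩
  let _ : MeasurableSpace C(↥(Iic a ∪ Ici b), ℝ) := borel _
  have _ : BorelSpace C(↥(Iic a ∪ Ici b), ℝ) := ⟨rfl⟩
  have hab' : (a : ℝ) < b := hab
  set l := ((b : ℝ) - a) / 4 with hl
  have hl0 : 0 < l := by rw [hl]; linarith
  set J := weightedIntegral g (tentPath a b) with hJ
  set U : Ω → C(Icc (0 : ℝ) T, ℝ) :=
    path (residual W a b) (continuous_residual hW.continuous_paths a b) with hU
  set B : Ω → ℝ := fun ω => J / l * deviation W a b ω with hB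
  have hUm : Measurable U := measurable_path (hW.measurable_residual a b) _
  have hBm : Measurable B := (hW.measurable_deviation a b).const_mul _
  have hind : IndepFun U B P :=
    (hW.indepFun_residual_deviation hT hab).comp (ψ := fun x => J / l * x) measurable_id
      (measurable_id.const_mul _)
  -- Linearity of the functional isolates the hidden part `B`, whose variance is `(J / l)² * l = J²
  -- / l`.
  have hdecomp : ∀ ω, z + weightedIntegral g (path W hW.continuous_paths ω)
      = (z + weightedIntegral g (U ω)) + B ω := by
    intro ω
    rw [path_eq_residual hW.continuous_paths a b ω, weightedIntegral_add_smul hg]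
    simp only [hB, hU, hJ, hl]
    ring
  have hlawZ : HasLaw (fun ω => z + weightedIntegral g (path W hW.continuous_paths ω))
      (gaussianReal z (wienerVariance T f)) P := by
    have := gaussianReal_const_add (hW.hasLaw_weightedIntegral hT hfg hg hC hfT) z
    rwa [zero_add] at this
  have hBlaw : HasLaw B (gaussianReal 0 ⟨J ^ 2 / l, by positivity⟩) P := by
    have := gaussianReal_const_mul (hW.hasLaw_deviation hT hab.le) (J / l)
    rw [mul_zero] at this
    convert! this using 1
    congr 1
    apply NNReal.eq
    have h1 : ((l.toNNReal : NNReal) : ℝ) = l := Real.coe_toNNReal _ hl0.le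
    rw [NNReal.coe_mul, ← hl, h1]
    change J ^ 2 / l = (J / l) ^ 2 * l
    field_simp
  have hαm : Measurable fun w : C(Icc (0 : ℝ) T, ℝ) => z + weightedIntegral g w :=
    (continuous_const.add (continuous_weightedIntegral hg)).measurable
  have hum : Measurable fun w : C(Icc (0 : ℝ) T, ℝ) => u (w.restrict (Iic a ∪ Ici b)) :=
    Measurable.comp hu (ContinuousMap.continuous_restrict (Iic a ∪ Ici b)).measurable
  have hFint : Integrable (fun ω => F ((z + weightedIntegral g (U ω)) + B ω)) P := by
    simp_rw [← hdecomp]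
    have := hF
    rw [← hlawZ.map_eq] at this
    exact this.comp_aemeasurable hlawZ.aemeasurable
  have hmain := le_lintegral_sub_of_indepFun hUm hBm hind hαm hum hs hs1 hFint (q := q)
    fun x => by rw [hBlaw.map_eq]; exact hq _ rfl x
  simp_rw [← hdecomp] at hmain
  have hpush : ∀ {φ : ℝ → ℝ}, AEStronglyMeasurable φ (gaussianReal z (wienerVariance T f)) →
      ∫ ω, φ (z + weightedIntegral g (path W hW.continuous_paths ω)) ∂P
        = ∫ x, φ x ∂(gaussianReal z (wienerVariance T f)) := by
    intro φ hφ
    rw [← hlawZ.map_eq] at hφ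
    rw [← hlawZ.map_eq, integral_map hlawZ.aemeasurable hφ]
  rw [hpush (φ := fun x => F x * s x) (hF.aestronglyMeasurable.mul hs.aestronglyMeasurable),
    hpush (φ := fun x => |F x|) hF.abs.aestronglyMeasurable] at hmain
  refine hmain.trans_eq (lintegral_congr fun ω => ?_)
  rw [restrict_path_eq hW.continuous_paths hab.le]

end IsBrownianMotion

/-- The part of the Wiener integral that is hidden in `(a, b)` has a variance bounded from below in
terms of `b - a`. -/
lemma exists_le_weightedIntegral_tentPath {τ : ℝ} (hτT : τ ≤ T) {g : ℝ → ℝ} (hg : Continuous g)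
    (hg0 : ∀ x, 0 ≤ g x) (hgpos : ∀ x < τ, 0 < g x) {ε : ℝ} (hε : 0 < ε) :
    ∃ θ > 0, ∀ a b : Icc (0 : ℝ) T, (b : ℝ) ≤ τ → ε ≤ (b : ℝ) - a →
      θ ≤ (weightedIntegral g (tentPath a b)) ^ 2 / (((b : ℝ) - a) / 4) := by
  by_cases hne : ε ≤ τ
  swap
  -- For `ε > τ` no admissible pair `a`, `b` exists, so any positive constant serves.
  · refine ⟨1, one_pos, fun a b hb hab => ?_⟩
    linarith [a.2.1]
  have hT : 0 ≤ T := by linarith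
  obtain ⟨x₀, hx₀, hmin⟩ := isCompact_Icc.exists_isMinOn (s := Icc 0 (τ - ε / 2))
    ⟨0, left_mem_Icc.2 (by linarith)⟩ hg.continuousOn
  have hc : 0 < g x₀ := hgpos _ (by linarith [hx₀.2])
  -- On `[a + ℓ/4, a + ℓ/2]` the tent is at least `ℓ/8`, and `g ≥ g x₀` since `a + ℓ/2 ≤ τ - ε/2`.
  -- So the integral is at least `g x₀ * ℓ² / 32`; its square over `ℓ/4` is at least `(g x₀)² * ℓ³ /
  -- 256`.
  refine ⟨(g x₀) ^ 2 * ε ^ 3 / 256, by positivity, fun a b hb hab => ?_⟩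
  set ℓ := (b : ℝ) - a with hℓ
  have hℓ0 : 0 < ℓ := hε.trans_le hab
  have hab' : (a : ℝ) ≤ b := by linarith
  have hcont : Continuous fun s => g s * tent a b s := hg.mul (continuous_tent _ _)
  have hJ : weightedIntegral g (tentPath a b) = ∫ s in (0 : ℝ)..T, g s * tent a b s := by
    rw [weightedIntegral, integral_lebesgue_univ_eq hT]
    refine intervalIntegral.integral_congr fun s hs => ?_
    rw [uIcc_of_le hT] at hs
    simp only [IccExtend_of_mem hT _ hs]
    rfl
  have h1 : ∫ s in (a + ℓ / 4)..(a + ℓ / 2), g s * tent a b s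
      ≤ ∫ s in (0 : ℝ)..T, g s * tent a b s := by
    refine intervalIntegral.integral_mono_interval (by linarith [a.2.1]) (by linarith)
      (by linarith) (ae_of_all _ fun s => mul_nonneg (hg0 s) (tent_nonneg hab' s))
      (hcont.intervalIntegrable _ _)
  have h2 : ∫ _ in ((a : ℝ) + ℓ / 4)..(a + ℓ / 2), g x₀ * (ℓ / 8)
      ≤ ∫ s in (a + ℓ / 4)..(a + ℓ / 2), g s * tent a b s := by
    refine intervalIntegral.integral_mono_on (by linarith) (by simp)
      (hcont.intervalIntegrable _ _) fun s hs => ?_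
    have h3 : g x₀ ≤ g s := hmin ⟨by linarith [hs.1, a.2.1], by linarith [hs.2]⟩
    rw [tent_of_mem (by linarith [hs.1]) (by linarith [hs.2])]
    exact mul_le_mul h3 (by linarith [hs.1]) (by positivity) (hg0 s)
  have h3 : g x₀ * ℓ ^ 2 / 32 ≤ weightedIntegral g (tentPath a b) := by
    rw [hJ]
    refine le_trans (le_of_eq ?_) (h2.trans h1)
    rw [intervalIntegral.integral_const, smul_eq_mul]
    ring
  rw [le_div_iff₀ (by positivity)]
  have h4 : (g x₀ * ℓ ^ 2 / 32) ^ 2 ≤ (weightedIntegral g (tentPath a b)) ^ 2 :=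
    pow_le_pow_left₀ (by positivity) h3 2
  refine le_trans ?_ h4
  have h5 : ε ^ 3 ≤ ℓ ^ 3 := pow_le_pow_left₀ hε.le hab 3
  calc (g x₀) ^ 2 * ε ^ 3 / 256 * (ℓ / 4) ≤ (g x₀) ^ 2 * ℓ ^ 3 / 256 * (ℓ / 4) := by gcongr
    _ = _ := by ring

end Hidden

/-! ### Concrete smooth coefficient functions -/

lemma expNegInvGlue_le_one (x : ℝ) : expNegInvGlue x ≤ 1 := by
  unfold expNegInvGlue
  split_ifs with h
  · exact zero_le_one
  · rw [Real.exp_le_one_iff, neg_nonpos, inv_nonneg]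
    exact (not_le.1 h).le

/-- The intensity of the noise at time `s`: smooth, decreasing to `0` at time `τ`. -/
noncomputable def intensity (τ s : ℝ) : ℝ := expNegInvGlue (τ - s)

/-- Minus the derivative of `intensity`. -/
noncomputable def weight (τ s : ℝ) : ℝ := (τ - s)⁻¹ ^ 2 * expNegInvGlue (τ - s)

lemma hasDerivAt_intensity (τ s : ℝ) : HasDerivAt (intensity τ) (-weight τ s) s := by
  have h := expNegInvGlue.hasDerivAt_polynomial_eval_inv_mul 1 (τ - s)
  simp only [Polynomial.eval_one, one_mul, Polynomial.derivative_one, sub_zero, mul_one,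
    Polynomial.eval_pow, Polynomial.eval_X] at h
  have := h.comp s ((hasDerivAt_id s).const_sub τ)
  convert! this using 1
  simp [weight]

lemma contDiff_intensity (τ : ℝ) : ContDiff ℝ (⊤ : ℕ∞) (intensity τ) :=
  expNegInvGlue.contDiff.comp (contDiff_const.sub contDiff_id)

/-- The defining formula has a singular factor at `τ`; continuity is inherited from the derivative
of a smooth function. -/
lemma continuous_weight (τ : ℝ) : Continuous (weight τ) := by
  have h1 : weight τ = fun s => -deriv (intensity τ) s := by
    ext s; rw [(hasDerivAt_intensity τ s).deriv, neg_neg]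
  rw [h1]
  exact ((contDiff_intensity τ).continuous_deriv (by simp)).neg

lemma weight_nonneg (τ s : ℝ) : 0 ≤ weight τ s :=
  mul_nonneg (sq_nonneg _) (expNegInvGlue.nonneg _)

lemma weight_pos {τ s : ℝ} (hs : s < τ) : 0 < weight τ s :=
  mul_pos (pow_pos (inv_pos.2 (sub_pos.2 hs)) 2) (expNegInvGlue.pos_of_pos (sub_pos.2 hs))

lemma weight_eq_zero {τ s : ℝ} (hs : τ ≤ s) : weight τ s = 0 := by
  rw [weight, expNegInvGlue.zero_of_nonpos (sub_nonpos.2 hs), mul_zero]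

lemma intensity_eq_zero {τ s : ℝ} (hs : τ ≤ s) : intensity τ s = 0 :=
  expNegInvGlue.zero_of_nonpos (sub_nonpos.2 hs)

lemma abs_intensity_le (τ s : ℝ) : |intensity τ s| ≤ 1 := by
  rw [intensity, abs_of_nonneg (expNegInvGlue.nonneg _)]
  exact expNegInvGlue_le_one _

lemma wienerVariance_intensity_ne_zero {T τ : ℝ} (hτ : 0 < τ) (hτT : τ ≤ T) :
    wienerVariance T (intensity τ) ≠ 0 := by
  have hm : Measurable fun s : Icc (0 : ℝ) T => ‖intensity τ s‖ₑ ^ 2 :=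
    (((contDiff_intensity τ).continuous.measurable.comp measurable_subtype_coe).enorm).pow_const 2
  refine (ENNReal.toNNReal_pos (fun h0 => ?_) ?_).ne'
  · rw [lintegral_eq_zero_iff hm] at h0
    have h1 : lebesgue T (Ioc ⟨0, left_mem_Icc.2 (hτ.le.trans hτT)⟩ ⟨τ / 2, by constructor <;> linarith⟩)
        = 0 := by
      refine measure_mono_null (fun s hs => ?_) (ae_iff.1 h0)
      have h2 : (s : ℝ) ≤ τ / 2 := hs.2
      have h3 : 0 < intensity τ s := expNegInvGlue.pos_of_pos (by linarith)
      simp [h3.ne']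
    rw [lebesgue_Ioc, ENNReal.ofReal_eq_zero] at h1
    simp only at h1
    linarith
  · refine ne_top_of_le_ne_top (b := ∫⁻ _ : Icc (0 : ℝ) T, 1 ∂(lebesgue T)) ?_
      (lintegral_mono fun s => ?_)
    · rw [lintegral_const]; finiteness
    · refine pow_le_one₀ zero_le ?_
      rw [← enorm_one (G := ℝ), enorm_le_iff_norm_le]
      simpa using abs_intensity_le τ s

/-- A bump supported in `[τ, L]`. -/
noncomputable def window (τ L x : ℝ) : ℝ := expNegInvGlue (x - τ) * expNegInvGlue (L - x)

lemma contDiff_window (τ L : ℝ) : ContDiff ℝ (⊤ : ℕ∞) (window τ L) :=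
  (expNegInvGlue.contDiff.comp (contDiff_id.sub contDiff_const)).mul
    (expNegInvGlue.contDiff.comp (contDiff_const.sub contDiff_id))

lemma window_nonneg (τ L x : ℝ) : 0 ≤ window τ L x :=
  mul_nonneg (expNegInvGlue.nonneg _) (expNegInvGlue.nonneg _)

lemma integral_window_pos {τ L T : ℝ} (hτ : 0 ≤ τ) (hτL : τ < L) (hLT : L ≤ T) :
    0 < ∫ x in (0 : ℝ)..T, window τ L x := by
  refine intervalIntegral.integral_pos (by linarith) (contDiff_window τ L).continuous.continuousOn
    (fun x _ => window_nonneg τ L x) ⟨(τ + L) / 2, ⟨by linarith, by linarith⟩, ?_⟩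
  exact mul_pos (expNegInvGlue.pos_of_pos (by linarith)) (expNegInvGlue.pos_of_pos (by linarith))

/-- A smooth function that is `0` before `L` and `M` after `T`. -/
noncomputable def ramp (M L T x : ℝ) : ℝ := M * Real.smoothTransition ((x - L) / (T - L))

lemma contDiff_ramp (M L T : ℝ) : ContDiff ℝ (⊤ : ℕ∞) (ramp M L T) :=
  contDiff_const.mul (Real.smoothTransition.contDiff.comp
    ((contDiff_id.sub contDiff_const).div_const _))

/-- The ramp is constant past `T`, so a clock lead `r` is read out exactly linearly. -/
lemma integral_ramp {M L T r : ℝ} (hLT : L < T) (hr : 0 ≤ r) :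
    ∫ x in (0 : ℝ)..(T + r), ramp M L T x = (∫ x in (0 : ℝ)..T, ramp M L T x) + M * r := by
  have hc := (contDiff_ramp M L T).continuous
  rw [← intervalIntegral.integral_add_adjacent_intervals (hc.intervalIntegrable 0 T)
    (hc.intervalIntegrable T (T + r))]
  have : ∫ x in T..(T + r), ramp M L T x = ∫ _ in T..(T + r), M := by
    refine intervalIntegral.integral_congr fun x hx => ?_
    rw [uIcc_of_le (by linarith)] at hx
    rw [ramp, Real.smoothTransition.one_of_one_le, mul_one]
    rw [one_le_div (by linarith)]
    linarith [hx.1]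
  rw [this, intervalIntegral.integral_const, smul_eq_mul]
  ring

lemma isProfile_window_ramp {τ L T M : ℝ} (hLT : L < T) {h : ℝ → ℝ} (hc : Continuous h)
    (hh : ∀ x, h x ∈ Icc (0 : ℝ) (1 / 2)) :
    IsProfile τ L h (window τ L) (ramp M L T) where
  continuous_h := hc
  continuous_χ := (contDiff_window τ L).continuous
  continuous_κ := (contDiff_ramp M L T).continuous
  h_mem := hh
  χ_mem x := ⟨window_nonneg τ L x, mul_le_one₀ (expNegInvGlue_le_one _) (expNegInvGlue.nonneg _)
    (expNegInvGlue_le_one _)⟩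
  χ_left x hx := by rw [window, expNegInvGlue.zero_of_nonpos (by linarith), zero_mul]
  χ_right x hx := by rw [window, expNegInvGlue.zero_of_nonpos (x := L - x) (by linarith), mul_zero]
  κ_left x hx := by
    rw [ramp, Real.smoothTransition.zero_of_nonpos, mul_zero]
    exact div_nonpos_of_nonpos_of_nonneg (by linarith) (by linarith)

/-! ### Smoothness and boundedness of the coefficients -/

section Coefficients

variable {d : ℕ}

lemma contDiff_single {E : Type*} [NormedAddCommGroup E] [NormedSpace ℝ E] {φ : E → ℝ}
    (hφ : ContDiff ℝ (⊤ : ℕ∞) φ) (i : Fin d) :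
    ContDiff ℝ (⊤ : ℕ∞) fun x => (EuclideanSpace.single i (φ x) : EuclideanSpace ℝ (Fin d)) := by
  rw [contDiff_euclidean]
  intro k
  by_cases hk : k = i
  · subst hk; simpa using hφ
  · simpa [hk] using contDiff_const

lemma contDiff_coord (i : Fin d) :
    ContDiff ℝ (⊤ : ℕ∞) fun x : EuclideanSpace ℝ (Fin d) => x i :=
  contDiff_euclidean.1 contDiff_id i

lemma contDiff_diffusion (i j : Fin d) (c : ℝ) {f : ℝ → ℝ} (hf : ContDiff ℝ (⊤ : ℕ∞) f) :
    ContDiff ℝ (⊤ : ℕ∞) (diffusion i j c f) :=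
  contDiff_single (hf.comp ((contDiff_coord j).sub contDiff_const)) i

lemma IsProfile.contDiff_drift {τ L : ℝ} {h χ κ : ℝ → ℝ} (hp : IsProfile τ L h χ κ)
    (i j : Fin d) (c : ℝ) (hh : ContDiff ℝ (⊤ : ℕ∞) h) (hχ : ContDiff ℝ (⊤ : ℕ∞) χ)
    (hκ : ContDiff ℝ (⊤ : ℕ∞) κ) : ContDiff ℝ (⊤ : ℕ∞) (drift i j c h χ κ) := by
  have hj : ContDiff ℝ (⊤ : ℕ∞) fun x : EuclideanSpace ℝ (Fin d) => x j - c :=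
    (contDiff_coord j).sub contDiff_const
  refine (contDiff_single (hκ.comp hj) i).add (contDiff_single (ContDiff.inv (contDiff_const.sub
    ((hh.comp (contDiff_coord i)).mul (hχ.comp hj))) fun x => ?_) j)
  have := hp.mul_le (x i) (x j - c)
  exact fun h0 : 1 - h (x i) * χ (x j - c) = 0 => by linarith

lemma IsProfile.norm_drift_le {τ L : ℝ} {h χ κ : ℝ → ℝ} (hp : IsProfile τ L h χ κ)
    (i j : Fin d) (c : ℝ) {M : ℝ} (hM : ∀ x, |κ x| ≤ M) (x : EuclideanSpace ℝ (Fin d)) :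
    ‖drift i j c h χ κ x‖ ≤ M + 2 := by
  refine (norm_add_le _ _).trans ?_
  rw [PiLp.norm_single, PiLp.norm_single, Real.norm_eq_abs, Real.norm_eq_abs,
    abs_of_nonneg (zero_le_one.trans (hp.one_le_speed _ _))]
  exact add_le_add (hM _) (hp.speed_le_two _ _)

end Coefficients

end SlowSDE

/-! ### The main theorem -/

open SlowSDE
theorem lemma3p20 (T : ℝ) (hT : 0 < T) (τ : ℝ) (hτ : 0 < τ) (hτT : τ < T)
    (d : ℕ) (hd : 2 ≤ d) (ξ : EuclideanSpace ℝ (Fin d))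
    (ε : ℕ → ℝ) (hε : ∀ n, 0 < ε n ∧ ε n ≤ τ)
    (δ : ℕ → ℝ) (hδ : limsup (fun n => (δ n : EReal)) atTop ≤ 0) :
    ∃ (μ σ : EuclideanSpace ℝ (Fin d) → EuclideanSpace ℝ (Fin d)) (Φ : C(Icc (0 : ℝ) T, ℝ) → ℝ),
      ContDiff ℝ (⊤ : ℕ∞) μ ∧ ContDiff ℝ (⊤ : ℕ∞) σ ∧
      (∃ C : ℝ, ∀ x, ‖μ x‖ ≤ C) ∧ (∃ C : ℝ, ∀ x, ‖σ x‖ ≤ C) ∧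
      Measurable[borel C(Icc (0 : ℝ) T, ℝ)] Φ ∧
      ∀ (Ω : Type*) (mΩ : MeasurableSpace Ω) (P : Measure Ω) (_ : IsProbabilityMeasure P)
        (𝓕 : Filtration (Icc (0 : ℝ) T) mΩ) (_ : IsNormalFiltration P 𝓕)
        (W : Icc (0 : ℝ) T → Ω → ℝ) (hW : IsBrownianMotion P 𝓕 W)
        (X : Icc (0 : ℝ) T → Ω → EuclideanSpace ℝ (Fin d)) (_ : IsSDESolution P 𝓕 W ξ μ σ X)
        (n : ℕ),
        (∀ᵐ ω ∂P, X ⟨T, right_mem_Icc.2 hT.le⟩ ω ⟨0, by omega⟩ =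
          Φ (path W hW.continuous_paths ω)) ∧
        ENNReal.ofReal (δ n) ≤
          ⨅ (a : Icc (0 : ℝ) T) (b : Icc (0 : ℝ) T)
            (_ : (a : ℝ) ≤ τ ∧ (b : ℝ) ≤ τ ∧ ε n ≤ (b : ℝ) - (a : ℝ))
            (u : C(↥(Iic a ∪ Ici b), ℝ) → ℝ) (_ : Measurable[borel C(↥(Iic a ∪ Ici b), ℝ)] u),
            ∫⁻ ω, ‖X ⟨T, right_mem_Icc.2 hT.le⟩ ω ⟨0, by omega⟩ -
              u ((path W hW.continuous_paths ω).restrict (Iic a ∪ Ici b))‖ₑ ∂P := by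
  set i : Fin d := ⟨0, by omega⟩ with hi
  set j : Fin d := ⟨1, by omega⟩ with hj
  have hij : i ≠ j := by simp [hi, hj]
  set L := (τ + T) / 2 with hL
  have hτL : τ < L := by rw [hL]; linarith
  have hLT : L < T := by rw [hL]; linarith
  have hδη : ∀ η > 0, ∀ᶠ n in atTop, δ n ≤ η := by
    intro η hη
    have h1 : limsup (fun n => (δ n : EReal)) atTop < (η : EReal) :=
      hδ.trans_lt (by exact_mod_cast hη)
    filter_upwards [eventually_lt_of_limsup_lt h1] with n hn
    exact_mod_cast hn.le
  obtain ⟨D, hD⟩ : ∃ D, ∀ n, δ n ≤ D := by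
    obtain ⟨D, hD⟩ := (isBoundedUnder_of_eventually_le (hδη 1 one_pos)).bddAbove_range
    exact ⟨D, fun n => hD ⟨n, rfl⟩⟩
  set v := wienerVariance T (intensity τ) with hv
  have hv0 : v ≠ 0 := wienerVariance_intensity_ne_zero hτ hτT.le
  have hp : ∀ k : ℕ, 0 < (gaussianReal (ξ i) v).real (Icc (4 * k - 1) (4 * k + 1)) := fun k =>
    gaussianReal_real_Icc_pos _ hv0 (by linarith)
  set p : ℕ → ℝ := fun k => (gaussianReal (ξ i) v).real (Icc (4 * k - 1) (4 * k + 1)) with hpdef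
  set Ξ := ∫ x in (0 : ℝ)..T, window τ L x with hΞ
  have hΞ0 : 0 < Ξ := integral_window_pos hτ.le hτL hLT.le
  -- Chosen so that the class `k = 0` already dominates every `δ n`.
  set M := 64 * |D| / p 0 + 1 with hM
  have hM0 : 0 < M := by
    have := hp 0
    positivity
  have hδp : ∀ n, δ n ≤ M / 64 * p 0 := by
    intro n
    have h0 : 0 < p 0 := hp 0
    have h1 : M / 64 * p 0 = |D| + p 0 / 64 := by rw [hM]; field_simp
    rw [h1]
    linarith [hD n, le_abs_self D]
  obtain ⟨e, he0, he⟩ := exists_threshold (c := fun k => M / 64 * p k)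
    (fun k => mul_pos (by positivity) (hp k)) (fun n => (hε n).1) hδη hδp
  -- The length thresholds `e k` become variance thresholds `θ k`, fixed before the frequencies of
  -- `h` are chosen.
  choose θ hθ0 hθ using fun k => exists_le_weightedIntegral_tentPath hτT.le (continuous_weight τ)
    (weight_nonneg τ) (fun x hx => weight_pos hx) (he0 k)
  -- The clock lead is `h(z) * Ξ`; height `M / Ξ` turns it into the displacement `M * h(z)`.
  set κ := ramp (M / Ξ) L T with hκ
  obtain ⟨h, hh1, hh2, hF, hh3⟩ := exists_oscillation_test (ξ i) hv0 (∫ x in (0 : ℝ)..T, κ x) hM0 hθ0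
  have hprof : IsProfile τ L h (window τ L) κ := isProfile_window_ramp hLT hh1.continuous hh2
  set F : ℝ → ℝ := fun x => x + (∫ x in (0 : ℝ)..T, κ x) + M * h x with hFdef
  have hFc : Continuous F :=
    (continuous_id.add continuous_const).add (continuous_const.mul hh1.continuous)
  refine ⟨drift i j (ξ j) h (window τ L) κ, diffusion i j (ξ j) (intensity τ),
    fun w => F (ξ i + weightedIntegral (weight τ) w),
    hprof.contDiff_drift i j _ hh1 (contDiff_window τ L) (contDiff_ramp _ L T),
    contDiff_diffusion i j _ (contDiff_intensity τ),
    ⟨M / Ξ + 2, hprof.norm_drift_le i j _ fun x => ?_⟩, ⟨1, fun x => ?_⟩, ?_, ?_⟩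
  · rw [hκ, ramp, abs_of_nonneg (mul_nonneg (by positivity) (Real.smoothTransition.nonneg _))]
    exact mul_le_of_le_one_right (by positivity) (Real.smoothTransition.le_one _)
  · rw [diffusion, PiLp.norm_single, Real.norm_eq_abs]
    exact abs_intensity_le _ _
  · let _ : MeasurableSpace C(Icc (0 : ℝ) T, ℝ) := borel _
    have _ : BorelSpace C(Icc (0 : ℝ) T, ℝ) := ⟨rfl⟩
    exact (hFc.comp (continuous_const.add
      (continuous_weightedIntegral (continuous_weight τ)))).measurable
  intro Ω mΩ P hP 𝓕 _ W hW X hX n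
  have hterm : ∀ᵐ ω ∂P, X ⟨T, right_mem_Icc.2 hT.le⟩ ω i
      = F (ξ i + weightedIntegral (weight τ) (path W hW.continuous_paths ω)) := by
    filter_upwards [hX.coord_terminal hτ.le hτL.le hLT.le hprof (hasDerivAt_intensity τ)
      (continuous_weight τ) (abs_intensity_le τ) (fun s hs => intensity_eq_zero hs)
      (fun s hs => weight_eq_zero hs) hij hW] with ω hω
    rw [hω, ← hΞ, hκ, integral_ramp hLT (mul_nonneg (hh2 _).1 hΞ0.le), hFdef]
    field_simp
    ring
  refine ⟨hterm, ?_⟩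
  obtain ⟨k, hk, hδk⟩ := he n
  obtain ⟨s, q, hs, hs1, hq, hlow⟩ := hh3 k
  refine le_iInf fun a => le_iInf fun b => le_iInf fun hab => le_iInf fun u => le_iInf fun hu => ?_
  have hlt : a < b := by
    have := (hε n).1
    exact Subtype.coe_lt_coe.1 (by linarith [hab.2.2])
  have hβ := hθ k a b hab.2.1 (hk.trans hab.2.2)
  have hmain := hW.le_lintegral_sub_restrict hT.le (hasDerivAt_intensity τ) (continuous_weight τ)
    (abs_intensity_le τ) (intensity_eq_zero hτT.le) hlt hs hs1 hF
    (fun β h1 x => hq β (h1 ▸ hβ) x) hu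
  refine (ENNReal.ofReal_le_ofReal (hδk.trans hlow)).trans (hmain.trans_eq ?_)
  refine lintegral_congr_ae ?_
  filter_upwards [hterm] with ω hω
  rw [hω]
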